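/- Let $n\ge 1$, let $h$ be the standard metric of the unit sphere $\mathbb S^n\subset\mathbb R^{n+1}$, let $Q$ be a real skew-symmetric $(n+1)\times(n+1)$ matrix with $|xQ|<1$ for all $x\in\mathbb S^n$ ($x$ a row vector), and let $W=xQ|_{\mathbb S^n}$, a vector field on $\mathbb S^n$ with $\|W\|_h<1$. Let $$F(y)=\frac{\sqrt{\lambda\,h(y,y)+h(W,y)^2}-h(W,y)}{\lambda},\qquad \lambda=1-h(W,W),$$ be the Randers metric on $\mathbb S^n$ with navigation datum $(h,W)$, and let $d\mu_{BH}$ be its Busemann--Hausdorff volume form, $d\mu_{BH}=\sigma\,dx^1\wedge\dots\wedge dx^n$ with $\sigma=\mathrm{vol}(\mathbb B^n)/\mathrm{vol}\{v\in\mathbb R^n: F(v^i\partial_i)<1\}$ in local coordinates. For a function $f$ on $\mathbb S^n$ put $N_f=\{df\ne0\}$; let $\nabla f=\mathcal L^{-1}(df)$ be the Finsler gradient, where $\mathcal L(y)=d_y\big(\tfrac12F^2\big)$ is the Legendre transformation, and $\Delta f=\mathrm{div}_\sigma(\nabla f)=\sigma^{-1}\sum_i\partial_i\big(\sigma(\nabla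 f)^i\big)$ the Finsler Laplacian on $N_f$. A non-constant $C^1$ function $f$ that is smooth on $N_f$ is called isoparametric for $(\mathbb S^n,F,d\mu_{BH})$ if there are a smooth function $\tilde a$ and a continuous function $\tilde b$ on $f(N_f)$ with $F(\nabla f)=\tilde a(f)$ and $\Delta f=\tilde b(f)$ on $N_f$. Let $k\in\mathbb R$ and let $\Phi:\mathbb R^{n+1}\to\mathbb R$ be homogeneous of degree $k$ ($\Phi(tx)=t^k\Phi(x)$ for all $t>0$ and all $x$), $C^1$ on $\mathbb R^{n+1}\setminus\{0\}$ and non-constant on $\mathbb S^n$. Let $\nabla^E$ and $\Delta^E$ be the Euclidean gradient and Laplacian of $\mathbb R^{n+1}$, put $R=\{x\in\mathbb S^n:\nabla^E\Phi-k\Phi x\neq0\}$ (the set of points of $\mathbb S^n$ at which $d(\Phi|_{\mathbb S^n})\ne0$), and assume that $\Phi$ is smooth near every point of $R$. **Theorem.** $\Phi|_{\mathbb S^n}$ is isoparametric for $(\mathbb S^n,F,d\mu_{BH})$ if and only if there are a smooth function $\varphi$ and a continuous function $\psi$ on $\Phi(R)$ such that, at every point $x\in R$, $$\left\{\begin{aligned}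 &|\nabla^E\Phi-k\Phi x|+\langle\nabla^E\Phi,xQ\rangle=\varphi(\Phi),\\ &\frac{\Delta^E\Phi-k(k+n-1)\Phi}{|\nabla^E\Phi-k\Phi x|}+\frac{\big\langle\nabla^E\langle\nabla^E\Phi,xQ\rangle,\ \nabla^E\Phi-k\Phi x\big\rangle}{|\nabla^E\Phi|^2-k^2\Phi^2}=\psi(\Phi). \end{aligned}\right.$$ -/

import Mathlib

open scoped Manifold ContDiff

noncomputable section

section Finsler

variable {n : ℕ} {M : Type*} [TopologicalSpace M] [ChartedSpace (EuclideanSpace ℝ (Fin n)) M]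

/-- The Legendre transformation `ℒ : T_xM → T_x*M` of a Finsler metric `F`: the differential of
`F² / 2` along the fibre, that is `F(y) F_{y^i}(y) dx^i` for `y ≠ 0`, and `0` for `y = 0`. -/
def legendre (F : ∀ x : M, TangentSpace (𝓡 n) x → ℝ) (x : M) (y : TangentSpace (𝓡 n) x) :
    TangentSpace (𝓡 n) x →L[ℝ] ℝ :=
  fderiv ℝ (fun z : TangentSpace (𝓡 n) x => F x z ^ 2 / 2) y

/-- The differential `df(x) ∈ T_x*M`. -/
def differential (f : M → ℝ) (x : M) : TangentSpace (𝓡 n) x →L[ℝ] ℝ :=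
  mfderiv (𝓡 n) 𝓘(ℝ, ℝ) f x

/-- The (nonlinear) Finsler gradient `∇f(x) = ℒ⁻¹(df(x))`. The Legendre transformation of a
Finsler metric is a bijection, so `Function.invFun` is its inverse. -/
def finslerGradient (F : ∀ x : M, TangentSpace (𝓡 n) x → ℝ) (f : M → ℝ) (x : M) :
    TangentSpace (𝓡 n) x :=
  Function.invFun (legendre F x) (differential f x)

/-- The density `σ` of the Busemann-Hausdorff volume form `σ dx¹ ∧ ⋯ ∧ dxⁿ` of `F`, in the
coordinates of the preferred chart at `p`, at the coordinate point `u`: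
`σ(u) = vol (𝔹ⁿ) / vol {v ∈ ℝⁿ | F(vⁱ ∂ᵢ) < 1}`. -/
def bhDensity (F : ∀ x : M, TangentSpace (𝓡 n) x → ℝ) (p : M) (u : EuclideanSpace ℝ (Fin n)) :
    ℝ :=
  (MeasureTheory.volume (Metric.ball (0 : EuclideanSpace ℝ (Fin n)) 1)).toReal /
    (MeasureTheory.volume {v : EuclideanSpace ℝ (Fin n) |
      F ((extChartAt (𝓡 n) p).symm u)
        (mfderiv (𝓡 n) (𝓡 n) (extChartAt (𝓡 n) p).symm u v) < 1}).toReal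

/-- The components `(X¹, …, Xⁿ)` of a vector field `X` in the preferred chart at `p`, at the
coordinate point `u`. -/
def chartComponents (X : ∀ x : M, TangentSpace (𝓡 n) x) (p : M)
    (u : EuclideanSpace ℝ (Fin n)) : EuclideanSpace ℝ (Fin n) :=
  mfderiv (𝓡 n) (𝓡 n) (extChartAt (𝓡 n) p) ((extChartAt (𝓡 n) p).symm u)
    (X ((extChartAt (𝓡 n) p).symm u))

/-- The divergence `σ⁻¹ ∑ᵢ ∂ᵢ(σ Xⁱ)` of `X` at `p` with respect to a volume form with density
`σ p` in the preferred chart at `p`. (The value does not depend on the chart used.) -/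
def divergence (σ : M → EuclideanSpace ℝ (Fin n) → ℝ) (X : ∀ x : M, TangentSpace (𝓡 n) x)
    (p : M) : ℝ :=
  (∑ i : Fin n, fderiv ℝ (fun u => σ p u * chartComponents X p u i) (extChartAt (𝓡 n) p p)
    (EuclideanSpace.single i 1)) / σ p (extChartAt (𝓡 n) p p)

/-- The Finsler Laplacian `Δf = div_σ(∇f)` with respect to the volume form of density `σ`. -/
def finslerLaplacian (F : ∀ x : M, TangentSpace (𝓡 n) x → ℝ)
    (σ : M → EuclideanSpace ℝ (Fin n) → ℝ) (f : M → ℝ) (x : M) : ℝ :=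
  divergence σ (finslerGradient F f) x

/-- The open set `N_f` of the points where `df ≠ 0`. -/
def regularSet (n : ℕ) {M : Type*} [TopologicalSpace M]
    [ChartedSpace (EuclideanSpace ℝ (Fin n)) M] (f : M → ℝ) : Set M :=
  {x | differential (n := n) f x ≠ 0}

/-- `f` is an isoparametric function of the Finsler manifold `(M, F)` with the volume form of
density `σ`: it is non-constant, `C¹`, smooth on `N_f`, and on `N_f` it satisfies
`F(∇f) = a(f)` and `Δf = b(f)`, where `a` is smooth and `b` is continuous on `J = f(N_f)`. -/
structure IsIsoparametric (F : ∀ x : M, TangentSpace (𝓡 n) x → ℝ)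
    (σ : M → EuclideanSpace ℝ (Fin n) → ℝ) (f : M → ℝ) : Prop where
  nonconstant : ¬ ∃ c : ℝ, ∀ x, f x = c
  contMDiff_one : ContMDiff (𝓡 n) 𝓘(ℝ, ℝ) 1 f
  smoothOn : ContMDiffOn (𝓡 n) 𝓘(ℝ, ℝ) ∞ f (regularSet n f)
  equations : ∃ a b : ℝ → ℝ,
    ContDiffOn ℝ ∞ a (f '' regularSet n f) ∧ ContinuousOn b (f '' regularSet n f) ∧
    ∀ x ∈ regularSet n f,
      F x (finslerGradient F f x) = a (f x) ∧ finslerLaplacian F σ f x = b (f x)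

/-- The Randers metric with navigation datum `(h, W)`, where `‖W‖_h < 1`:
`F(y) = (√(λ h(y,y) + h(W,y)²) - h(W,y)) / λ` with `λ = 1 - h(W,W)`; equivalently, for `y ≠ 0`,
`F(y)` is the positive number with `‖y / F(y) - W‖_h = 1`. -/
def randersMetric (h : ∀ x : M, TangentSpace (𝓡 n) x → TangentSpace (𝓡 n) x → ℝ)
    (W : ∀ x : M, TangentSpace (𝓡 n) x) (x : M) (y : TangentSpace (𝓡 n) x) : ℝ :=
  (√((1 - h x (W x) (W x)) * h x y y + h x (W x) y ^ 2) - h x (W x) y) / (1 - h x (W x) (W x))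

end Finsler

section Sphere

variable {n : ℕ}

/-- The unit sphere `𝕊ⁿ` in `ℝⁿ⁺¹`. -/
abbrev UnitSphere (n : ℕ) : Type := Metric.sphere (0 : EuclideanSpace ℝ (Fin (n + 1))) 1

/-- The differential at `x` of the inclusion of the unit sphere in `ℝⁿ⁺¹`, which identifies
`T_x𝕊ⁿ` with the orthogonal complement of `x`. -/
def sphereIncl (x : UnitSphere n) :
    TangentSpace (𝓡 n) x →L[ℝ] EuclideanSpace ℝ (Fin (n + 1)) :=
  mfderiv (𝓡 n) 𝓘(ℝ, EuclideanSpace ℝ (Fin (n + 1)))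
    (fun z : UnitSphere n => (z : EuclideanSpace ℝ (Fin (n + 1)))) x

/-- The standard Riemannian metric of the unit sphere. -/
def sphereMetric (x : UnitSphere n) (u v : TangentSpace (𝓡 n) x) : ℝ :=
  inner ℝ (sphereIncl x u) (sphereIncl x v)

/-- The linear vector field `x ↦ x Q` (row vector times matrix) on `ℝⁿ⁺¹`. -/
def rowMul (Q : Matrix (Fin (n + 1)) (Fin (n + 1)) ℝ) (x : EuclideanSpace ℝ (Fin (n + 1))) :
    EuclideanSpace ℝ (Fin (n + 1)) :=
  WithLp.toLp 2 (Matrix.vecMul x.ofLp Q)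

/-- The vector field `∇^E Φ - k Φ x` on `ℝⁿ⁺¹`. -/
def tangentialGrad (Φ : EuclideanSpace ℝ (Fin (n + 1)) → ℝ) (k : ℝ)
    (x : EuclideanSpace ℝ (Fin (n + 1))) : EuclideanSpace ℝ (Fin (n + 1)) :=
  gradient Φ x - (k * Φ x) • x

/-- The points of the unit sphere at which `∇^E Φ - k Φ x ≠ 0`. For `Φ` homogeneous of degree
`k`, these are the points where the differential of the restriction of `Φ` to the sphere does
not vanish. -/
def sphereRegularSet (Φ : EuclideanSpace ℝ (Fin (n + 1)) → ℝ) (k : ℝ) :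
    Set (EuclideanSpace ℝ (Fin (n + 1))) :=
  {x | x ∈ Metric.sphere (0 : EuclideanSpace ℝ (Fin (n + 1))) 1 ∧ tangentialGrad Φ k x ≠ 0}

end Sphere

end

/-! Write τ = ∇Φ - kΦx. By Euler's identity τ is tangent to the sphere at its points, so there it is
the Riemannian gradient of the restriction of Φ. The unit ball of F is the unit ball of h translated
by W, which has two consequences. The dual norm of the differential is A = |τ| + ⟨τ, W⟩, and the
Finsler gradient is A(τ/|τ| + W) (`legendre_navigationNorm_iff`). Translation preserves volume, so
the Busemann-Hausdorff density is that of the round sphere (`bhDensity_randersMetric`), and the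
divergence at p is the trace over the tangent space of the derivative of an ambient extension
(`divergence_bhDensity_randersMetric`).

The first equation of the system is therefore F(∇f) = a(f). Granted it, dA = a'(Φ) dΦ along the
sphere. The product rule for the divergence of A(τ/|τ| + W) gives a'(Φ)A from differentiating A, and
differentiating 1/|τ| gives -a'(Φ)A plus the mixed term of the second equation. The two multiples of
a' cancel and W is divergence free since Q is skew, so Δf is A times the left side of the second
equation (`sum_inner_fderiv_randersGrad`). Since |W| < 1 forces A > 0, the two systems correspond
through b = φψ. -/

noncomputable section

/-! ### Randers norms by navigation and their Legendre transformation -/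

section Navigation

variable {H : Type*} [NormedAddCommGroup H] [InnerProductSpace ℝ H]

/-- The Randers norm with navigation datum the inner product of `H` and the vector `w`. -/
def navigationNorm (w z : H) : ℝ :=
  (√((1 - inner ℝ w w) * inner ℝ z z + inner ℝ w z ^ 2) - inner ℝ w z) / (1 - inner ℝ w w)

theorem one_sub_inner_self_pos {w : H} (hw : ‖w‖ < 1) : 0 < 1 - inner ℝ w w := by
  rw [real_inner_self_eq_norm_sq]
  nlinarith [norm_nonneg w]

theorem navigation_radicand_pos {w z : H} (hw : ‖w‖ < 1) (hz : z ≠ 0) :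
    0 < (1 - inner ℝ w w) * inner ℝ z z + inner ℝ w z ^ 2 := by
  have h1 := one_sub_inner_self_pos hw
  have h2 : 0 < inner ℝ z z := real_inner_self_pos.2 hz
  positivity

theorem navigation_radicand_nonneg {w : H} (z : H) (hw : ‖w‖ < 1) :
    0 ≤ (1 - inner ℝ w w) * inner ℝ z z + inner ℝ w z ^ 2 := by
  have h1 := one_sub_inner_self_pos hw
  have h2 : 0 ≤ inner ℝ z z := real_inner_self_nonneg
  positivity

theorem navigationNorm_mul_add {w : H} (z : H) (hw : ‖w‖ < 1) :
    (1 - inner ℝ w w) * navigationNorm w z + inner ℝ w z =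
      √((1 - inner ℝ w w) * inner ℝ z z + inner ℝ w z ^ 2) := by
  have h1 := one_sub_inner_self_pos hw
  unfold navigationNorm
  field_simp
  ring

/-- This is |z - Fw|² = F² multiplied out. Later arguments use it in place of the square root. -/
theorem navigationNorm_quadratic {w : H} (z : H) (hw : ‖w‖ < 1) :
    (1 - inner ℝ w w) * navigationNorm w z ^ 2 + 2 * navigationNorm w z * inner ℝ w z =
      inner ℝ z z := by
  have h1 := one_sub_inner_self_pos hw
  have h2 := navigationNorm_mul_add z hw
  have h3 := Real.sq_sqrt (navigation_radicand_nonneg z hw)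
  rw [← h2] at h3
  have h4 : (1 - inner ℝ w w) * ((1 - inner ℝ w w) * navigationNorm w z ^ 2 +
      2 * navigationNorm w z * inner ℝ w z) = (1 - inner ℝ w w) * inner ℝ z z := by
    linear_combination h3
  exact mul_left_cancel₀ h1.ne' h4

theorem navigationNorm_pos {w z : H} (hw : ‖w‖ < 1) (hz : z ≠ 0) : 0 < navigationNorm w z := by
  have h1 := one_sub_inner_self_pos hw
  have h2 : 0 < inner ℝ z z := real_inner_self_pos.2 hz
  refine div_pos (sub_pos.2 (Real.lt_sqrt_of_sq_lt ?_)) h1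
  have := mul_pos h1 h2
  linarith

theorem navigationNorm_eq {w z : H} (hw : ‖w‖ < 1) {c : ℝ} (hc : 0 ≤ c)
    (h : ‖z - c • w‖ = c) : navigationNorm w z = c := by
  have h1 := one_sub_inner_self_pos hw
  have h2 : inner ℝ z z - 2 * c * inner ℝ w z + c ^ 2 * inner ℝ w w = c ^ 2 := by
    have h3 : inner ℝ (z - c • w) (z - c • w) = c ^ 2 := by
      rw [real_inner_self_eq_norm_sq, h]
    rw [inner_sub_left, inner_sub_right, inner_sub_right, inner_smul_left, inner_smul_right,
      inner_smul_left, inner_smul_right, real_inner_comm w z] at h3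
    simp only [conj_trivial] at h3
    linear_combination h3
  have h4 : (1 - inner ℝ w w) * inner ℝ z z + inner ℝ w z ^ 2 =
      ((1 - inner ℝ w w) * c + inner ℝ w z) ^ 2 := by
    linear_combination (1 - inner ℝ w w) * h2
  -- The sign selects the right root of the quadratic. Were it negative, `h2` would give |z|² ≤ -(1
  -- - |w|²)c², forcing c = 0 and then z = 0.
  have h5 : 0 ≤ (1 - inner ℝ w w) * c + inner ℝ w z := by
    by_contra! h6
    have h7 : 0 ≤ inner ℝ z z := real_inner_self_nonneg
    have h8 : 0 ≤ (1 - inner ℝ w w) * c := by positivity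
    have h9 : c * inner ℝ w z ≤ c * (-((1 - inner ℝ w w) * c)) :=
      mul_le_mul_of_nonneg_left (by linarith) hc
    have h10 : c = 0 := by
      by_contra h11
      have h12 : 0 < c := lt_of_le_of_ne hc (Ne.symm h11)
      have h13 : 0 < (1 - inner ℝ w w) * c * c := by positivity
      nlinarith
    subst h10
    have h14 : z = 0 := by simpa using h
    simp [h14] at h6
  unfold navigationNorm
  rw [h4, Real.sqrt_sq h5]
  field_simp
  ring

/-- The unit ball is a translated round ball; the volume computation rests on this. -/
theorem navigationNorm_lt_one_iff {w z : H} (hw : ‖w‖ < 1) :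
    navigationNorm w z < 1 ↔ ‖z - w‖ < 1 := by
  have h1 := one_sub_inner_self_pos hw
  have h7 : 0 ≤ inner ℝ z z := real_inner_self_nonneg
  have h2 : ‖z - w‖ < 1 ↔ inner ℝ z z < (1 - inner ℝ w w) + 2 * inner ℝ w z := by
    rw [← sq_lt_one_iff₀ (norm_nonneg _), ← real_inner_self_eq_norm_sq, inner_sub_left,
      inner_sub_right, inner_sub_right, real_inner_comm w z]
    constructor <;> intro h <;> linarith
  rw [h2]
  unfold navigationNorm
  rw [div_lt_one h1, sub_lt_iff_lt_add]
  constructor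
  · intro h
    have h3 := Real.lt_sq_of_sqrt_lt h
    have h4 : (1 - inner ℝ w w) * inner ℝ z z <
      (1 - inner ℝ w w) * ((1 - inner ℝ w w) + 2 * inner ℝ w z) := by linarith
    exact lt_of_mul_lt_mul_left h4 h1.le
  · intro h
    have h4 := mul_lt_mul_of_pos_left h h1
    rw [Real.sqrt_lt' (by linarith)]
    linarith

theorem differentiableAt_navigationNorm {w z : H} (hw : ‖w‖ < 1) (hz : z ≠ 0) :
    DifferentiableAt ℝ (navigationNorm w) z := by
  have h := (navigation_radicand_pos hw hz).ne'
  have h1 : DifferentiableAt ℝ (fun y : H => inner ℝ w y) z := (innerSL ℝ w).differentiableAt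
  have h2 : DifferentiableAt ℝ (fun y : H => inner ℝ y y) z :=
    differentiableAt_id.inner ℝ differentiableAt_id
  exact ((((h2.const_mul _).add (h1.pow 2)).sqrt h).sub h1).mul_const _

/-- Implicit differentiation of `navigationNorm_quadratic`, halved; the factor on the left is the
positive square root of `navigationNorm_mul_add`. -/
theorem fderiv_navigationNorm {w z : H} (hw : ‖w‖ < 1) (hz : z ≠ 0) (v : H) :
    fderiv ℝ (navigationNorm w) z v *
      ((1 - inner ℝ w w) * navigationNorm w z + inner ℝ w z) =
      inner ℝ (z - navigationNorm w z • w) v := by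
  have hg := (differentiableAt_navigationNorm hw hz).hasFDerivAt
  have hi : HasFDerivAt (fun y : H => inner ℝ w y) (innerSL ℝ w) z := (innerSL ℝ w).hasFDerivAt
  have h1 := ((hg.pow 2).const_mul (1 - inner ℝ w w)).add ((hg.const_mul 2).mul hi)
  have h2 : HasFDerivAt (fun y : H => inner ℝ y y) _ z :=
    (hasFDerivAt_id z).inner ℝ (hasFDerivAt_id z)
  have h3 := h1.unique (h2.congr_of_eventuallyEq
    (Filter.Eventually.of_forall fun y => navigationNorm_quadratic y hw))
  have h4 := DFunLike.congr_fun h3 v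
  simp [real_inner_comm v z] at h4
  rw [inner_sub_left, inner_smul_left, real_inner_comm v z, real_inner_self_eq_norm_sq]
  simp only [conj_trivial]
  linarith

variable {T : Type*} [NormedAddCommGroup T] [NormedSpace ℝ T]

/-- On each ray from 0 the function is a multiple of t², so its one-sided derivatives vanish. This
excludes y = 0 as a Legendre preimage of a nonzero covector. -/
theorem fderiv_sq_navigationNorm_zero (w : H) (J : T →L[ℝ] H) :
    fderiv ℝ (fun y => navigationNorm w (J y) ^ 2 / 2) 0 = 0 := by
  have hsymm : ∀ (t : ℝ) (y : T), 0 ≤ t →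
      navigationNorm w (J (t • y)) = t * navigationNorm w (J y) := by
    intro t y ht
    unfold navigationNorm
    rw [map_smul, inner_smul_left, inner_smul_right, inner_smul_right]
    simp only [conj_trivial]
    rw [show (1 - inner ℝ w w) * (t * (t * inner ℝ (J y) (J y))) + (t * inner ℝ w (J y)) ^ 2 =
      t ^ 2 * ((1 - inner ℝ w w) * inner ℝ (J y) (J y) + inner ℝ w (J y) ^ 2) by ring,
      Real.sqrt_mul (sq_nonneg t), Real.sqrt_sq ht]
    ring
  by_cases hd : DifferentiableAt ℝ (fun y => navigationNorm w (J y) ^ 2 / 2) 0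
  · ext v
    have h1 : HasDerivAt (fun t : ℝ => navigationNorm w (J (t • v)) ^ 2 / 2)
        (fderiv ℝ (fun y => navigationNorm w (J y) ^ 2 / 2) 0 v) 0 := by
      have h2 : HasDerivAt (fun t : ℝ => t • v) v 0 := by
        simpa using (hasDerivAt_id (0 : ℝ)).smul_const v
      have h3 : HasFDerivAt (fun y => navigationNorm w (J y) ^ 2 / 2)
        (fderiv ℝ (fun y => navigationNorm w (J y) ^ 2 / 2) 0) ((0 : ℝ) • v) := by
        rw [zero_smul]; exact hd.hasFDerivAt
      exact h3.comp_hasDerivAt 0 h2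
    have h4 : HasDerivAt (fun t : ℝ => t ^ 2 * (navigationNorm w (J v) ^ 2 / 2)) 0 0 := by
      simpa using ((hasDerivAt_pow 2 (0 : ℝ)).mul_const (navigationNorm w (J v) ^ 2 / 2))
    have h5 := (h1.hasDerivWithinAt (s := Set.Ici 0)).congr (f₁ := fun t : ℝ =>
      t ^ 2 * (navigationNorm w (J v) ^ 2 / 2)) (fun t ht => by
        rw [hsymm t v ht]; ring) (by rw [hsymm 0 v le_rfl]; ring)
    exact (uniqueDiffWithinAt_Ici 0).eq_deriv _ h5 h4.hasDerivWithinAt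
  -- Without differentiability the default value of `fderiv` is 0 as well.
  · exact fderiv_zero_of_not_differentiableAt hd

theorem fderiv_sq_navigationNorm {w : H} (hw : ‖w‖ < 1) (J : T →L[ℝ] H) {y : T} (hy : J y ≠ 0)
    (v : T) :
    fderiv ℝ (fun y => navigationNorm w (J y) ^ 2 / 2) y v =
      inner ℝ ((navigationNorm w (J y) / ((1 - inner ℝ w w) * navigationNorm w (J y) +
        inner ℝ w (J y))) • (J y - navigationNorm w (J y) • w)) (J v) := by
  have hg := (differentiableAt_navigationNorm hw hy).hasFDerivAt
  have h1 : HasFDerivAt (fun y => navigationNorm w (J y)) _ y := hg.comp y J.hasFDerivAt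
  have h2 := (h1.pow 2).mul_const (1 / 2 : ℝ)
  have h3 : (fun y => navigationNorm w (J y) ^ 2 / 2) =
      fun y => navigationNorm w (J y) ^ 2 * (1 / 2) := by
    funext y; ring
  have h4 : 0 < (1 - inner ℝ w w) * navigationNorm w (J y) + inner ℝ w (J y) := by
    rw [navigationNorm_mul_add _ hw]
    exact Real.sqrt_pos.2 (navigation_radicand_pos hw hy)
  rw [h3, h2.fderiv, inner_smul_left, ← fderiv_navigationNorm hw hy]
  rw [real_inner_self_eq_norm_sq] at h4 ⊢
  have h5 : navigationNorm w (J y) * (1 - ‖w‖ ^ 2) + inner ℝ w (J y) ≠ 0 := by linarith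
  simp
  field_simp

theorem norm_add_inner_pos {w τ : H} (hw : ‖w‖ < 1) (hτ : τ ≠ 0) : 0 < ‖τ‖ + inner ℝ τ w := by
  have h1 := abs_real_inner_le_norm τ w
  have h2 : ‖τ‖ * ‖w‖ < ‖τ‖ * 1 := mul_lt_mul_of_pos_left hw (norm_pos_iff.2 hτ)
  have h3 := neg_abs_le (inner ℝ τ w)
  linarith

/-- With A = |τ| + ⟨τ, w⟩, the vector minus Aw is A times a unit vector, so `navigationNorm_eq`
applies with c = A. -/
theorem navigationNorm_dual {w τ : H} (hw : ‖w‖ < 1) (hτ : τ ≠ 0) :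
    navigationNorm w ((‖τ‖ + inner ℝ τ w) • (‖τ‖⁻¹ • τ + w)) = ‖τ‖ + inner ℝ τ w := by
  have h1 := norm_add_inner_pos hw hτ
  refine navigationNorm_eq hw h1.le ?_
  rw [smul_add, add_sub_cancel_right, norm_smul, norm_smul, norm_inv, norm_norm,
    inv_mul_cancel₀ (norm_ne_zero_iff.2 hτ), mul_one, Real.norm_of_nonneg h1.le]

/-- The equivalence supplies both existence and uniqueness of the preimage, as `Function.invFun`
requires. The covector at y is represented by (g/d)(y - gW), where g is the norm of y and |y - gW| =
g; hence |t| = g²/d and |t| + ⟨t, W⟩ = g, and y can be solved for. -/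
theorem legendre_navigationNorm_iff {J : T →L[ℝ] H} (hJ : Function.Injective J) {W t y : T}
    (hw : ‖J W‖ < 1) (ht : J t ≠ 0) :
    fderiv ℝ (fun y => navigationNorm (J W) (J y) ^ 2 / 2) y = (innerSL ℝ (J t)).comp J ↔
      y = (‖J t‖ + inner ℝ (J t) (J W)) • (‖J t‖⁻¹ • t + W) := by
  have hA := norm_add_inner_pos hw ht
  have htn : 0 < ‖J t‖ := norm_pos_iff.2 ht
  constructor
  · intro h
    have hy : y ≠ 0 := by
      rintro rfl
      rw [fderiv_sq_navigationNorm_zero] at h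
      have := DFunLike.congr_fun h t
      simp at this
      exact htn.ne (pow_eq_zero_iff two_ne_zero |>.1 this.symm).symm
    have hy' : J y ≠ 0 := fun h0 => hy (hJ (by simpa using h0))
    have hg := navigationNorm_pos hw hy'
    have h4 : 0 < (1 - inner ℝ (J W) (J W)) * navigationNorm (J W) (J y) +
        inner ℝ (J W) (J y) := by
      rw [navigationNorm_mul_add _ hw]
      exact Real.sqrt_pos.2 (navigation_radicand_pos hw hy')
    have hq := navigationNorm_quadratic (J y) hw
    set g := navigationNorm (J W) (J y) with hgdef
    set d := (1 - inner ℝ (J W) (J W)) * g + inner ℝ (J W) (J y) with hd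
    have h5 : ∀ v, inner ℝ ((g / d) • (J y - g • J W)) (J v) = inner ℝ (J t) (J v) := by
      intro v
      rw [← fderiv_sq_navigationNorm hw J hy' v, h]
      simp
    -- Testing `h5` on the difference of the two sides shows that its image under J has norm zero.
    have h6 : (g / d) • (y - g • W) = t := by
      refine hJ (sub_eq_zero.1 ?_)
      rw [← map_sub, ← inner_self_eq_zero (𝕜 := ℝ)]
      have h7 := h5 ((g / d) • (y - g • W) - t)
      rw [← sub_eq_zero, ← inner_sub_left] at h7
      convert h7 using 2
      simp
    have h8 : ‖J y - g • J W‖ = g := by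
      rw [← sq_eq_sq₀ (norm_nonneg _) hg.le, ← real_inner_self_eq_norm_sq, inner_sub_left,
        inner_sub_right, inner_sub_right, inner_smul_left, inner_smul_right, inner_smul_left,
        inner_smul_right, real_inner_comm (J W) (J y)]
      simp only [conj_trivial]
      linear_combination -hq
    have h9 : ‖J t‖ = g / d * g := by
      rw [← h6, map_smul, norm_smul, map_sub, map_smul, h8, Real.norm_of_nonneg (by positivity)]
    have h10 : ‖J t‖ + inner ℝ (J t) (J W) = g := by
      rw [h9, ← h6, map_smul, map_sub, map_smul, inner_smul_left, inner_sub_left, inner_smul_left,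
        real_inner_comm (J W) (J y)]
      simp only [conj_trivial]
      field_simp
      rw [hd]
      ring
    rw [h10, h9]
    rw [← h6, smul_smul, smul_add, smul_smul, show g * ((g / d * g)⁻¹ * (g / d)) = 1 by field_simp]
    simp
  · intro h
    have hJy : J y = (‖J t‖ + inner ℝ (J t) (J W)) • (‖J t‖⁻¹ • J t + J W) := by
      rw [h]; simp
    have hg := navigationNorm_dual hw ht
    rw [← hJy] at hg
    have hy' : J y ≠ 0 := by
      intro h0
      rw [h0] at hg
      simp [navigationNorm] at hg
      exact hA.ne hg
    ext v
    rw [fderiv_sq_navigationNorm hw J hy', hg, hJy]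
    simp only [ContinuousLinearMap.comp_apply, innerSL_apply_apply]
    congr 1
    rw [smul_add (‖J t‖ + inner ℝ (J t) (J W)), add_sub_cancel_right, inner_add_right,
      inner_smul_right, inner_smul_right, inner_smul_right, real_inner_comm (J t) (J W),
      smul_smul, smul_smul]
    generalize inner ℝ (J t) (J W) = a at *
    generalize inner ℝ (J W) (J W) = b at *
    have h1 : (1 - b) * (‖J t‖ + a) + ((‖J t‖ + a) * (‖J t‖⁻¹ * a) + (‖J t‖ + a) * b) =
        (‖J t‖ + a) ^ 2 * ‖J t‖⁻¹ := by
      field_simp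
      ring
    rw [h1, show (‖J t‖ + a) / ((‖J t‖ + a) ^ 2 * ‖J t‖⁻¹) * (‖J t‖ + a) * ‖J t‖⁻¹ = 1 by
      field_simp, one_smul]

end Navigation

/-! ### Inverse stereographic projection and its conformality -/

section StereographicParametrization

variable {V H : Type*} [NormedAddCommGroup V] [InnerProductSpace ℝ V]
  [NormedAddCommGroup H] [InnerProductSpace ℝ H]

/-- The inverse of the stereographic projection from `-p` of the unit sphere of `H`, with the
orthogonal complement of `p` parametrized by the isometry `U`. -/
def stereoParam (U : V →ₗᵢ[ℝ] H) (p : H) (u : V) : H :=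
  (‖u‖ ^ 2 + 4)⁻¹ • ((4 : ℝ) • U u + (4 - ‖u‖ ^ 2) • p)

/-- The differential of `stereoParam`. -/
def stereoParamDeriv (U : V →ₗᵢ[ℝ] H) (p : H) (u : V) : V →L[ℝ] H :=
  (4 / (‖u‖ ^ 2 + 4)) • U.toContinuousLinearMap -
    (innerSL ℝ u).smulRight ((8 / (‖u‖ ^ 2 + 4) ^ 2) • U u + (16 / (‖u‖ ^ 2 + 4) ^ 2) • p)

theorem hasFDerivAt_norm_sq_add_four (u : V) :
    HasFDerivAt (fun u : V => ‖u‖ ^ 2 + 4) (2 • innerSL ℝ u) u :=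
  (hasStrictFDerivAt_norm_sq u).hasFDerivAt.add_const 4

theorem hasFDerivAt_stereoParam (U : V →ₗᵢ[ℝ] H) (p : H) (u : V) :
    HasFDerivAt (stereoParam U p) (stereoParamDeriv U p u) u := by
  have hs : ‖u‖ ^ 2 + 4 ≠ 0 := by positivity
  have h1 := hasFDerivAt_norm_sq_add_four u
  have h2 : HasFDerivAt (fun u : V => (‖u‖ ^ 2 + 4)⁻¹) _ u :=
    (hasDerivAt_inv hs).comp_hasFDerivAt u h1
  have h3 : HasFDerivAt (fun u : V => ‖u‖ ^ 2) _ u := (hasStrictFDerivAt_norm_sq u).hasFDerivAt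
  have h4 : HasFDerivAt (fun u : V => U u) U.toContinuousLinearMap u :=
    U.toContinuousLinearMap.hasFDerivAt
  have h5 := h2.smul ((h4.const_smul (4 : ℝ)).add ((h3.const_sub 4).smul_const p))
  refine h5.congr_fderiv ?_
  ext v
  simp [stereoParamDeriv]
  match_scalars <;> field_simp <;> ring

/-- Conformality turns metric balls into coordinate balls and lets the differential be inverted by
its adjoint. -/
theorem inner_stereoParamDeriv {U : V →ₗᵢ[ℝ] H} {p : H} (hp : ‖p‖ = 1)
    (hU : ∀ u, inner ℝ p (U u) = 0) (u v w : V) :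
    inner ℝ (stereoParamDeriv U p u v) (stereoParamDeriv U p u w) =
      (4 / (‖u‖ ^ 2 + 4)) ^ 2 * inner ℝ v w := by
  have hs : ‖u‖ ^ 2 + 4 ≠ 0 := by positivity
  have hU' : ∀ u, inner ℝ (U u) p = 0 := fun u => by rw [real_inner_comm]; exact hU u
  simp only [stereoParamDeriv, sub_apply, smul_apply,
    ContinuousLinearMap.smulRight_apply, innerSL_apply_apply,
    LinearIsometry.coe_toContinuousLinearMap, inner_sub_left, inner_sub_right, inner_add_left,
    inner_add_right, inner_smul_left, inner_smul_right, hU, hU', U.inner_map_map, conj_trivial,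
    real_inner_self_eq_norm_sq, hp, real_inner_comm u v]
  field_simp
  ring

theorem norm_stereoParamDeriv {U : V →ₗᵢ[ℝ] H} {p : H} (hp : ‖p‖ = 1)
    (hU : ∀ u, inner ℝ p (U u) = 0) (u v : V) :
    ‖stereoParamDeriv U p u v‖ = 4 / (‖u‖ ^ 2 + 4) * ‖v‖ := by
  rw [← sq_eq_sq₀ (norm_nonneg _) (by positivity), ← real_inner_self_eq_norm_sq,
    inner_stereoParamDeriv hp hU, real_inner_self_eq_norm_sq, mul_pow]

theorem stereoParam_zero (U : V →ₗᵢ[ℝ] H) (p : H) : stereoParam U p 0 = p := by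
  simp [stereoParam, smul_smul]

theorem stereoParamDeriv_zero (U : V →ₗᵢ[ℝ] H) (p : H) (v : V) :
    stereoParamDeriv U p 0 v = U v := by
  simp [stereoParamDeriv]

end StereographicParametrization

/-! ### Volume density and divergence in the sphere's charts -/

section SphereChart

variable {n : ℕ}

local notation "𝔼" => EuclideanSpace ℝ (Fin n)
local notation "𝔽" => EuclideanSpace ℝ (Fin (n + 1))

theorem extChartAt_sphere_target (p : UnitSphere n) : (extChartAt (𝓡 n) p).target = Set.univ := by
  have : Fact (Module.finrank ℝ 𝔽 = n + 1) := ⟨finrank_euclideanSpace_fin⟩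
  rw [extChartAt_target]
  change _ ∩ _ = _
  have : (chartAt 𝔼 p).target = Set.univ := stereographic'_target (-p)
  simp [this]

theorem extChartAt_sphere_self (p : UnitSphere n) : extChartAt (𝓡 n) p p = 0 := by
  have : Fact (Module.finrank ℝ 𝔽 = n + 1) := ⟨finrank_euclideanSpace_fin⟩
  change (OrthonormalBasis.fromOrthogonalSpanSingleton (𝕜 := ℝ) n
    (ne_zero_of_mem_unit_sphere (-p))).repr (stereographic (norm_eq_of_mem_sphere (-p)) p) = 0
  rw [stereographic_neg_apply, map_zero]

/-- The preferred chart at p projects from -p, followed by orthonormal coordinates on the complement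
of p. Only the resulting isometry U matters afterwards. -/
theorem exists_extChartAt_sphere_symm_eq (p : UnitSphere n) :
    ∃ U : 𝔼 →ₗᵢ[ℝ] 𝔽, (∀ u, inner ℝ (p : 𝔽) (U u) = 0) ∧
      ∀ u, (((extChartAt (𝓡 n) p).symm u : UnitSphere n) : 𝔽) = stereoParam U (p : 𝔽) u := by
  have : Fact (Module.finrank ℝ 𝔽 = n + 1) := ⟨finrank_euclideanSpace_fin⟩
  let e := (OrthonormalBasis.fromOrthogonalSpanSingleton (𝕜 := ℝ) n
    (ne_zero_of_mem_unit_sphere (-p))).repr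
  refine ⟨(ℝ ∙ ((-p : UnitSphere n) : 𝔽))ᗮ.subtypeₗᵢ.comp e.symm.toLinearIsometry, ?_, ?_⟩
  · intro u
    have h := Submodule.mem_orthogonal_singleton_iff_inner_right.1 (e.symm u).2
    change inner ℝ (p : 𝔽) ((e.symm u : (ℝ ∙ ((-p : UnitSphere n) : 𝔽))ᗮ) : 𝔽) = 0
    simpa using h
  · intro u
    have h : (((extChartAt (𝓡 n) p).symm u : UnitSphere n) : 𝔽) = _ :=
      stereographic'_symm_apply (-p) u
    rw [h]
    have h2 : ‖((e.symm u : (ℝ ∙ ((-p : UnitSphere n) : 𝔽))ᗮ) : 𝔽)‖ = ‖u‖ := by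
      rw [Submodule.norm_coe, e.symm.norm_map]
    change (‖((e.symm u : (ℝ ∙ ((-p : UnitSphere n) : 𝔽))ᗮ) : 𝔽)‖ ^ 2 + 4)⁻¹ • (4 : ℝ) •
      ((e.symm u : (ℝ ∙ ((-p : UnitSphere n) : 𝔽))ᗮ) : 𝔽) +
      (‖((e.symm u : (ℝ ∙ ((-p : UnitSphere n) : 𝔽))ᗮ) : 𝔽)‖ ^ 2 + 4)⁻¹ •
      (‖((e.symm u : (ℝ ∙ ((-p : UnitSphere n) : 𝔽))ᗮ) : 𝔽)‖ ^ 2 - 4) • (-(p : 𝔽)) = _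
    rw [h2, stereoParam, smul_add]
    congr 2
    module

theorem mdifferentiableAt_extChartAt_sphere_symm (p : UnitSphere n) (u : 𝔼) :
    MDifferentiableAt (𝓡 n) (𝓡 n) (extChartAt (𝓡 n) p).symm u := by
  have h := mdifferentiableWithinAt_extChartAt_symm (I := 𝓡 n) (x := p) (z := u)
    (by rw [extChartAt_sphere_target]; trivial)
  rw [modelWithCornersSelf_coe, Set.range_id] at h
  exact mdifferentiableWithinAt_univ.1 h

theorem mdifferentiableAt_coe_sphere (x : UnitSphere n) :
    MDifferentiableAt (𝓡 n) 𝓘(ℝ, 𝔽) (fun z : UnitSphere n => (z : 𝔽)) x := by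
  have : Fact (Module.finrank ℝ 𝔽 = n + 1) := ⟨finrank_euclideanSpace_fin⟩
  exact (contMDiff_coe_sphere (m := 1) x).mdifferentiableAt one_ne_zero

theorem sphereIncl_mfderiv_extChartAt_symm {p : UnitSphere n} {U : 𝔼 →ₗᵢ[ℝ] 𝔽}
    (hι : ∀ u, (((extChartAt (𝓡 n) p).symm u : UnitSphere n) : 𝔽) = stereoParam U (p : 𝔽) u)
    (u v : 𝔼) :
    sphereIncl ((extChartAt (𝓡 n) p).symm u)
      (mfderiv (𝓡 n) (𝓡 n) (extChartAt (𝓡 n) p).symm u v) = stereoParamDeriv U (p : 𝔽) u v := by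
  have h1 := mfderiv_comp u (mdifferentiableAt_coe_sphere ((extChartAt (𝓡 n) p).symm u))
    (mdifferentiableAt_extChartAt_sphere_symm p u)
  have h2 : (fun z : UnitSphere n => (z : 𝔽)) ∘ (extChartAt (𝓡 n) p).symm =
      stereoParam U (p : 𝔽) := funext hι
  rw [h2, mfderiv_eq_fderiv, (hasFDerivAt_stereoParam U (p : 𝔽) u).fderiv] at h1
  rw [h1]
  rfl

theorem mfderiv_extChartAt_symm_comp (p : UnitSphere n) (u : 𝔼)
    (y : TangentSpace (𝓡 n) ((extChartAt (𝓡 n) p).symm u)) :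
    mfderiv (𝓡 n) (𝓡 n) (extChartAt (𝓡 n) p).symm u
      (mfderiv (𝓡 n) (𝓡 n) (extChartAt (𝓡 n) p) ((extChartAt (𝓡 n) p).symm u) y) = y := by
  have h := mfderivWithin_extChartAt_symm_comp_mfderiv_extChartAt (I := 𝓡 n) (x := p) (y := u)
    (by rw [extChartAt_sphere_target]; trivial)
  simp only [modelWithCornersSelf_coe, Set.range_id, mfderivWithin_univ] at h
  exact DFunLike.congr_fun h y

theorem stereoParamDeriv_chartComponents {p : UnitSphere n} {U : 𝔼 →ₗᵢ[ℝ] 𝔽}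
    (hι : ∀ u, (((extChartAt (𝓡 n) p).symm u : UnitSphere n) : 𝔽) = stereoParam U (p : 𝔽) u)
    (X : ∀ x : UnitSphere n, TangentSpace (𝓡 n) x) (u : 𝔼) :
    stereoParamDeriv U (p : 𝔽) u (chartComponents X p u) =
      sphereIncl ((extChartAt (𝓡 n) p).symm u) (X ((extChartAt (𝓡 n) p).symm u)) := by
  rw [← sphereIncl_mfderiv_extChartAt_symm hι]
  congr 1
  exact mfderiv_extChartAt_symm_comp p u _

theorem chartComponents_apply {p : UnitSphere n} {U : 𝔼 →ₗᵢ[ℝ] 𝔽}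
    (hU : ∀ u, inner ℝ (p : 𝔽) (U u) = 0)
    (hι : ∀ u, (((extChartAt (𝓡 n) p).symm u : UnitSphere n) : 𝔽) = stereoParam U (p : 𝔽) u)
    (X : ∀ x : UnitSphere n, TangentSpace (𝓡 n) x) (u : 𝔼) (i : Fin n) :
    chartComponents X p u i = ((‖u‖ ^ 2 + 4) / 4) ^ 2 *
      inner ℝ (stereoParamDeriv U (p : 𝔽) u (EuclideanSpace.single i 1))
        (sphereIncl ((extChartAt (𝓡 n) p).symm u) (X ((extChartAt (𝓡 n) p).symm u))) := by
  rw [← stereoParamDeriv_chartComponents hι, inner_stereoParamDeriv (by simp) hU,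
    EuclideanSpace.inner_single_left]
  have hs : ‖u‖ ^ 2 + 4 ≠ 0 := by positivity
  simp
  field_simp

theorem randersMetric_eq_navigationNorm (W : ∀ x : UnitSphere n, TangentSpace (𝓡 n) x)
    (x : UnitSphere n) (y : TangentSpace (𝓡 n) x) :
    randersMetric sphereMetric W x y = navigationNorm (sphereIncl x (W x)) (sphereIncl x y) := rfl

/-- In coordinates the unit ball of F is a Euclidean ball centred at the components of W, with
radius the inverse conformal factor. The centre does not affect the volume, so W drops out. -/
theorem bhDensity_randersMetric {W : ∀ x : UnitSphere n, TangentSpace (𝓡 n) x}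
    (hW : ∀ x, ‖sphereIncl x (W x)‖ < 1) {p : UnitSphere n} {U : 𝔼 →ₗᵢ[ℝ] 𝔽}
    (hU : ∀ u, inner ℝ (p : 𝔽) (U u) = 0)
    (hι : ∀ u, (((extChartAt (𝓡 n) p).symm u : UnitSphere n) : 𝔽) = stereoParam U (p : 𝔽) u)
    (u : 𝔼) :
    bhDensity (randersMetric sphereMetric W) p u = (4 / (‖u‖ ^ 2 + 4)) ^ n := by
  have hs : 0 < ‖u‖ ^ 2 + 4 := by positivity
  have h1 : {v : 𝔼 | randersMetric sphereMetric W ((extChartAt (𝓡 n) p).symm u)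
      (mfderiv (𝓡 n) (𝓡 n) (extChartAt (𝓡 n) p).symm u v) < 1} =
      Metric.ball (chartComponents W p u) ((‖u‖ ^ 2 + 4) / 4) := by
    ext v
    rw [Set.mem_ofPred_eq, randersMetric_eq_navigationNorm, navigationNorm_lt_one_iff (hW _),
      ← stereoParamDeriv_chartComponents hι, sphereIncl_mfderiv_extChartAt_symm hι, ← map_sub,
      norm_stereoParamDeriv (by simp) hU, mem_ball_iff_norm, lt_div_iff₀ (by norm_num),
      div_mul_eq_mul_div, div_lt_one hs, mul_comm]
  have h2 : 0 < (MeasureTheory.volume (Metric.ball (0 : 𝔼) 1)).toReal :=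
    ENNReal.toReal_pos (Metric.measure_ball_pos _ _ one_pos).ne' MeasureTheory.measure_ball_lt_top.ne
  unfold bhDensity
  rw [h1, MeasureTheory.Measure.addHaar_ball_of_pos _ (chartComponents W p u)
    (by positivity : 0 < (‖u‖ ^ 2 + 4) / 4), ENNReal.toReal_mul,
    ENNReal.toReal_ofReal (by positivity), finrank_euclideanSpace_fin]
  field_simp
  rw [← mul_pow]
  field_simp
  rw [one_pow]

theorem inner_coe_sphereIncl (x : UnitSphere n) (y : TangentSpace (𝓡 n) x) :
    inner ℝ (x : 𝔽) (sphereIncl x y) = 0 := by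
  have : Fact (Module.finrank ℝ 𝔽 = n + 1) := ⟨finrank_euclideanSpace_fin⟩
  have h := range_mvfderiv_subtypeVal (n := n) x
  refine Submodule.mem_orthogonal_singleton_iff_inner_right.1 ?_
  rw [← h]
  exact ⟨y, rfl⟩

theorem exists_sphereIncl_eq (x : UnitSphere n) {z : 𝔽} (hz : inner ℝ (x : 𝔽) z = 0) :
    ∃ y, sphereIncl x y = z := by
  have : Fact (Module.finrank ℝ 𝔽 = n + 1) := ⟨finrank_euclideanSpace_fin⟩
  have h := range_mvfderiv_subtypeVal (n := n) x
  have h2 := Submodule.mem_orthogonal_singleton_iff_inner_right.2 hz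
  rw [← h] at h2
  exact h2

theorem sphereIncl_injective (x : UnitSphere n) : Function.Injective (sphereIncl x) := by
  have : Fact (Module.finrank ℝ 𝔽 = n + 1) := ⟨finrank_euclideanSpace_fin⟩
  exact injective_mvfderiv_subtypeVal_sphere (n := n) x

/-- The chart is centred at p, where the conformal factor is 1 and stationary, so to first order the
coordinates are Euclidean and only the derivative of V survives. -/
theorem divergence_bhDensity_randersMetric {W : ∀ x : UnitSphere n, TangentSpace (𝓡 n) x}
    (hW : ∀ x, ‖sphereIncl x (W x)‖ < 1) {p : UnitSphere n} {U : 𝔼 →ₗᵢ[ℝ] 𝔽}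
    (hU : ∀ u, inner ℝ (p : 𝔽) (U u) = 0)
    (hι : ∀ u, (((extChartAt (𝓡 n) p).symm u : UnitSphere n) : 𝔽) = stereoParam U (p : 𝔽) u)
    {X : ∀ x : UnitSphere n, TangentSpace (𝓡 n) x} {V : 𝔽 → 𝔽}
    (hV : DifferentiableAt ℝ V (p : 𝔽))
    (hXV : ∀ᶠ u in nhds (0 : 𝔼), sphereIncl ((extChartAt (𝓡 n) p).symm u)
      (X ((extChartAt (𝓡 n) p).symm u)) = V (stereoParam U (p : 𝔽) u)) :
    divergence (bhDensity (randersMetric sphereMetric W)) X p =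
      ∑ i, inner ℝ (U (EuclideanSpace.single i 1))
        (fderiv ℝ V (p : 𝔽) (U (EuclideanSpace.single i 1))) := by
  have hV0 : inner ℝ (p : 𝔽) (V (p : 𝔽)) = 0 := by
    have h := hXV.self_of_nhds
    rw [stereoParam_zero] at h
    have h2 := inner_coe_sphereIncl _ (X ((extChartAt (𝓡 n) p).symm 0))
    rw [h, hι, stereoParam_zero] at h2
    exact h2
  have hVι : HasFDerivAt (fun u => V (stereoParam U (p : 𝔽) u))
      ((fderiv ℝ V (p : 𝔽)).comp (stereoParamDeriv U (p : 𝔽) 0)) 0 := by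
    have h1 : HasFDerivAt V (fderiv ℝ V (p : 𝔽)) (stereoParam U (p : 𝔽) 0) := by
      rw [stereoParam_zero]; exact hV.hasFDerivAt
    exact h1.comp 0 (hasFDerivAt_stereoParam U (p : 𝔽) 0)
  have hs : HasFDerivAt (fun u : 𝔼 => ‖u‖ ^ 2 + 4) (0 : 𝔼 →L[ℝ] ℝ) 0 := by
    simpa using hasFDerivAt_norm_sq_add_four (0 : 𝔼)
  -- Functions of |u|² have zero differential at the centre u = 0.
  have hscalar : ∀ g : ℝ → ℝ, DifferentiableAt ℝ g 4 →
      HasFDerivAt (fun u : 𝔼 => g (‖u‖ ^ 2 + 4)) (0 : 𝔼 →L[ℝ] ℝ) 0 := by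
    intro g hg
    have h1 : HasDerivAt g (deriv g 4) (‖(0 : 𝔼)‖ ^ 2 + 4) := by simpa using hg.hasDerivAt
    exact (h1.comp_hasFDerivAt (0 : 𝔼) hs).congr_fderiv (smul_zero _)
  unfold divergence
  rw [extChartAt_sphere_self, bhDensity_randersMetric hW hU hι]
  simp only [norm_zero, ne_eq, OfNat.ofNat_ne_zero, not_false_eq_true, zero_pow, zero_add,
    div_self, one_pow, div_one]
  refine Finset.sum_congr rfl fun i _ => ?_
  set e : 𝔼 := EuclideanSpace.single i 1 with he
  have h1 := hscalar (fun t => (4 / t) ^ n * (t / 4)) (by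
    have : (4 : ℝ) ≠ 0 := by norm_num
    fun_prop (disch := assumption))
  -- This factor gets multiplied by uᵢ, which vanishes at 0. Only its value there counts, namely ⟨p,
  -- V(p)⟩ = 0 by `hV0`.
  have h2 : DifferentiableAt ℝ (fun u : 𝔼 => (4 / (‖u‖ ^ 2 + 4)) ^ n *
      ((1 / 2) * inner ℝ (U u) (V (stereoParam U (p : 𝔽) u)) +
        inner ℝ (p : 𝔽) (V (stereoParam U (p : 𝔽) u)))) 0 := by
    have h3 := hscalar (fun t => (4 / t) ^ n) (by
      have : (4 : ℝ) ≠ 0 := by norm_num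
      fun_prop (disch := assumption))
    exact h3.differentiableAt.mul (((U.toContinuousLinearMap.differentiableAt.inner ℝ
      hVι.differentiableAt).const_mul _).add
      ((differentiableAt_const _).inner ℝ hVι.differentiableAt))
  have h4 : HasFDerivAt (fun u : 𝔼 => u i) (innerSL ℝ e) 0 := by
    have : (fun u : 𝔼 => u i) = innerSL ℝ e := by
      ext u
      simp [he, EuclideanSpace.inner_single_left]
    rw [this]
    exact (innerSL ℝ e).hasFDerivAt
  have h5 : HasFDerivAt (fun u => inner ℝ (U e) (V (stereoParam U (p : 𝔽) u)))
      ((innerSL ℝ (U e)).comp ((fderiv ℝ V (p : 𝔽)).comp (stereoParamDeriv U (p : 𝔽) 0))) 0 :=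
    (innerSL ℝ (U e)).hasFDerivAt.comp 0 hVι
  have h6 := (h1.mul h5).sub (h4.mul h2.hasFDerivAt)
  have h7 : (fun u : 𝔼 => bhDensity (randersMetric sphereMetric W) p u * chartComponents X p u i)
      =ᶠ[nhds 0] fun u => (4 / (‖u‖ ^ 2 + 4)) ^ n * ((‖u‖ ^ 2 + 4) / 4) *
        inner ℝ (U e) (V (stereoParam U (p : 𝔽) u)) - u i * ((4 / (‖u‖ ^ 2 + 4)) ^ n *
      ((1 / 2) * inner ℝ (U u) (V (stereoParam U (p : 𝔽) u)) +
        inner ℝ (p : 𝔽) (V (stereoParam U (p : 𝔽) u)))) := by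
    filter_upwards [hXV] with u hu
    have hs : ‖u‖ ^ 2 + 4 ≠ 0 := by positivity
    rw [bhDensity_randersMetric hW hU hι, chartComponents_apply hU hι, hu]
    simp only [stereoParamDeriv, sub_apply, smul_apply,
      ContinuousLinearMap.smulRight_apply, innerSL_apply_apply,
      LinearIsometry.coe_toContinuousLinearMap, inner_sub_left, inner_add_left,
      inner_smul_left, conj_trivial, ← he]
    have h8 : inner ℝ u e = u i := by
      rw [real_inner_comm, he, EuclideanSpace.inner_single_left]; simp
    rw [h8]
    field_simp
    ring
  rw [h7.fderiv_eq]
  erw [h6.fderiv]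
  simp [stereoParam_zero, hV0, stereoParamDeriv_zero]

end SphereChart

/-! ### Orthonormal frames adapted to a point of the sphere -/

section AdaptedFrame

variable {n : ℕ}

local notation "𝔼" => EuclideanSpace ℝ (Fin n)
local notation "𝔽" => EuclideanSpace ℝ (Fin (n + 1))

theorem exists_orthonormalBasis_cons {p : 𝔽} (hp : ‖p‖ = 1) {U : 𝔼 →ₗᵢ[ℝ] 𝔽}
    (hU : ∀ u, inner ℝ p (U u) = 0) :
    ∃ b : OrthonormalBasis (Fin (n + 1)) ℝ 𝔽, b 0 = p ∧
      ∀ i : Fin n, b i.succ = U (EuclideanSpace.single i 1) := by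
  have hU' : ∀ u, inner ℝ (U u) p = 0 := fun u => by rw [real_inner_comm]; exact hU u
  let v : Fin (n + 1) → 𝔽 := Fin.cons p fun i => U (EuclideanSpace.single i 1)
  have hv : Orthonormal ℝ v := by
    rw [orthonormal_iff_ite]
    intro i j
    refine Fin.cases ?_ (fun i => ?_) i <;> refine Fin.cases ?_ (fun j => ?_) j
    · simp [v, hp]
    · simp [v, hU, (Fin.succ_ne_zero j).symm]
    · simp [v, hU', Fin.succ_ne_zero i]
    · simp [v, EuclideanSpace.inner_single_left, PiLp.single_apply, Fin.succ_inj]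
  have hs : ⊤ ≤ Submodule.span ℝ (Set.range v) :=
    (hv.linearIndependent.span_eq_top_of_card_eq_finrank' (by simp)).ge
  refine ⟨OrthonormalBasis.mk hv hs, by simp [v], fun i => by simp [v]⟩

theorem sum_inner_smul_eq_of_orthogonal {p : 𝔽} (hp : ‖p‖ = 1) {U : 𝔼 →ₗᵢ[ℝ] 𝔽}
    (hU : ∀ u, inner ℝ p (U u) = 0) {v : 𝔽} (hv : inner ℝ p v = 0) :
    ∑ i, inner ℝ (U (EuclideanSpace.single i 1)) v • U (EuclideanSpace.single i 1) = v := by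
  obtain ⟨b, hb0, hb⟩ := exists_orthonormalBasis_cons hp hU
  have h := b.sum_repr' v
  rw [Fin.sum_univ_succ, hb0, hv, zero_smul, zero_add] at h
  simpa only [hb] using h

theorem exists_isometry_eq_of_orthogonal {p : 𝔽} (hp : ‖p‖ = 1) {U : 𝔼 →ₗᵢ[ℝ] 𝔽}
    (hU : ∀ u, inner ℝ p (U u) = 0) {v : 𝔽} (hv : inner ℝ p v = 0) : ∃ u, U u = v :=
  ⟨∑ i, inner ℝ (U (EuclideanSpace.single i 1)) v • EuclideanSpace.single i 1, by
    simpa using sum_inner_smul_eq_of_orthogonal hp hU hv⟩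

/-- The tangential trace of the rank-one map L ⊗ v, as it arises from the product rule. -/
theorem sum_apply_mul_inner_of_orthogonal {p : 𝔽} (hp : ‖p‖ = 1) {U : 𝔼 →ₗᵢ[ℝ] 𝔽}
    (hU : ∀ u, inner ℝ p (U u) = 0) {v : 𝔽} (hv : inner ℝ p v = 0) (L : 𝔽 →L[ℝ] ℝ) :
    ∑ i, L (U (EuclideanSpace.single i 1)) * inner ℝ (U (EuclideanSpace.single i 1)) v = L v := by
  conv_rhs => rw [← sum_inner_smul_eq_of_orthogonal hp hU hv]
  rw [map_sum]
  refine Finset.sum_congr rfl fun i _ => ?_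
  rw [map_smul, smul_eq_mul, mul_comm]

theorem inner_gradient_eq_fderiv (Φ : 𝔽 → ℝ) (x y : 𝔽) :
    inner ℝ (gradient Φ x) y = fderiv ℝ Φ x y := inner_gradient_left

theorem contDiffAt_gradient {Φ : 𝔽 → ℝ} {x : 𝔽} (hΦ : ContDiffAt ℝ ∞ Φ x) :
    ContDiffAt ℝ ∞ (gradient Φ) x := by
  have h1 : ContDiffAt ℝ ∞ (fderiv ℝ Φ) x := hΦ.fderiv_right (m := ∞) (by simp)
  exact ((InnerProductSpace.toDual ℝ 𝔽).symm.toContinuousLinearEquiv.contDiff.contDiffAt).comp x h1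

theorem fderiv_fderiv_apply {Φ : 𝔽 → ℝ} {x : 𝔽} (hΦ : ContDiffAt ℝ ∞ Φ x) (v w : 𝔽) :
    fderiv ℝ (fderiv ℝ Φ) x v w = inner ℝ (fderiv ℝ (gradient Φ) x v) w := by
  have hG := ((contDiffAt_gradient hΦ).differentiableAt (by simp)).hasFDerivAt
  have h1 : fderiv ℝ Φ = fun z => InnerProductSpace.toDual ℝ 𝔽 (gradient Φ z) := by
    funext z
    rw [toDual_gradient]
  have h2 := ((InnerProductSpace.toDual ℝ 𝔽).toContinuousLinearEquiv :
    𝔽 ≃L[ℝ] StrongDual ℝ 𝔽).toContinuousLinearMap.hasFDerivAt.comp x hG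
  rw [h1]
  erw [h2.fderiv]
  simp

theorem laplacian_eq_add_sum {Φ : 𝔽 → ℝ} {p : 𝔽} (hΦ : ContDiffAt ℝ ∞ Φ p) (hp : ‖p‖ = 1)
    {U : 𝔼 →ₗᵢ[ℝ] 𝔽} (hU : ∀ u, inner ℝ p (U u) = 0) :
    Laplacian.laplacian Φ p = inner ℝ (fderiv ℝ (gradient Φ) p p) p +
      ∑ i, inner ℝ (fderiv ℝ (gradient Φ) p (U (EuclideanSpace.single i 1)))
        (U (EuclideanSpace.single i 1)) := by
  obtain ⟨b, hb0, hb⟩ := exists_orthonormalBasis_cons hp hU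
  rw [InnerProductSpace.laplacian_eq_iteratedFDeriv_orthonormalBasis Φ b]
  simp only [iteratedFDeriv_two_apply, Matrix.cons_val_zero, Matrix.cons_val_one]
  rw [Fin.sum_univ_succ, hb0]
  simp only [hb, fderiv_fderiv_apply hΦ]

end AdaptedFrame

/-! ### Euler identities -/

section Homogeneous

variable {n : ℕ}

local notation "𝔽" => EuclideanSpace ℝ (Fin (n + 1))

theorem inner_gradient_self_of_homogeneous {k : ℝ} {Φ : 𝔽 → ℝ}
    (hom : ∀ (t : ℝ) (x : 𝔽), 0 < t → Φ (t • x) = t ^ k * Φ x) {x : 𝔽}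
    (hd : DifferentiableAt ℝ Φ x) : inner ℝ (gradient Φ x) x = k * Φ x := by
  rw [inner_gradient_eq_fderiv]
  have h1 : HasDerivAt (fun t : ℝ => t • x) x 1 := by
    simpa using (hasDerivAt_id (1 : ℝ)).smul_const x
  have h2 : HasFDerivAt Φ (fderiv ℝ Φ x) ((1 : ℝ) • x) := by
    rw [one_smul]; exact hd.hasFDerivAt
  have h3 : HasDerivAt (fun t : ℝ => Φ (t • x)) (fderiv ℝ Φ x x) 1 := h2.comp_hasDerivAt 1 h1
  have h4 : HasDerivAt (fun t : ℝ => t ^ k * Φ x) (k * Φ x) 1 := by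
    simpa using (Real.hasDerivAt_rpow_const (x := 1) (p := k) (Or.inl one_ne_zero)).mul_const (Φ x)
  refine h3.unique (h4.congr_of_eventuallyEq ?_)
  filter_upwards [lt_mem_nhds (zero_lt_one' ℝ)] with t ht using hom t x ht

theorem inner_tangentialGrad_self {k : ℝ} {Φ : 𝔽 → ℝ}
    (hom : ∀ (t : ℝ) (x : 𝔽), 0 < t → Φ (t • x) = t ^ k * Φ x) {x : 𝔽} (hx : ‖x‖ = 1)
    (hd : DifferentiableAt ℝ Φ x) : inner ℝ x (tangentialGrad Φ k x) = 0 := by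
  rw [tangentialGrad, inner_sub_right, inner_smul_right, real_inner_comm,
    inner_gradient_self_of_homogeneous hom hd, real_inner_self_eq_norm_sq, hx]
  ring

theorem norm_tangentialGrad_sq {k : ℝ} {Φ : 𝔽 → ℝ}
    (hom : ∀ (t : ℝ) (x : 𝔽), 0 < t → Φ (t • x) = t ^ k * Φ x) {x : 𝔽} (hx : ‖x‖ = 1)
    (hd : DifferentiableAt ℝ Φ x) :
    ‖tangentialGrad Φ k x‖ ^ 2 = ‖gradient Φ x‖ ^ 2 - k ^ 2 * Φ x ^ 2 := by
  rw [tangentialGrad, norm_sub_sq_real, inner_smul_right,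
    inner_gradient_self_of_homogeneous hom hd, norm_smul, hx, mul_one, Real.norm_eq_abs, sq_abs]
  ring

/-- Differentiating Euler's relation ⟨∇Φ, z⟩ = kΦ in the direction x gives Hess Φ(x, x) + kΦ = k²Φ.
-/
theorem inner_fderiv_gradient_self {k : ℝ} {Φ : 𝔽 → ℝ}
    (hom : ∀ (t : ℝ) (x : 𝔽), 0 < t → Φ (t • x) = t ^ k * Φ x) {x : 𝔽}
    (hΦ : ContDiffAt ℝ ∞ Φ x) :
    inner ℝ (fderiv ℝ (gradient Φ) x x) x = (k - 1) * (k * Φ x) := by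
  have hd : DifferentiableAt ℝ Φ x := hΦ.differentiableAt (by simp)
  have hG := ((contDiffAt_gradient hΦ).differentiableAt (by simp)).hasFDerivAt
  have h1 := hG.inner ℝ (hasFDerivAt_id x)
  have h2 := hd.hasFDerivAt.const_mul k
  have hev : (fun z => inner ℝ (gradient Φ z) (id z)) =ᶠ[nhds x] fun z => k * Φ z := by
    have h3 : ∀ᶠ z in nhds x, ContDiffAt ℝ 1 Φ z :=
      (hΦ.of_le (by simp)).eventually (by simp)
    filter_upwards [h3] with z hz
    exact inner_gradient_self_of_homogeneous hom (hz.differentiableAt one_ne_zero)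
  have h4 := DFunLike.congr_fun (h1.unique (h2.congr_of_eventuallyEq hev)) x
  have h5 := inner_gradient_self_of_homogeneous hom hd
  have h6 := inner_gradient_eq_fderiv Φ x x
  simp [h5, ← h6] at h4
  linarith

end Homogeneous

/-! ### The linear field of a skew-symmetric matrix -/

section RowMul

variable {n : ℕ}

local notation "𝔽" => EuclideanSpace ℝ (Fin (n + 1))

theorem inner_rowMul_self {Q : Matrix (Fin (n + 1)) (Fin (n + 1)) ℝ} (hQ : Q.transpose = -Q)
    (x : 𝔽) : inner ℝ x (rowMul Q x) = 0 := by
  have h1 : inner ℝ x (rowMul Q x) = Matrix.vecMul x.ofLp Q ⬝ᵥ x.ofLp := by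
    simp [rowMul, EuclideanSpace.inner_eq_star_dotProduct]
  have h2 : Matrix.vecMul x.ofLp Q ⬝ᵥ x.ofLp = - (Matrix.vecMul x.ofLp Q ⬝ᵥ x.ofLp) := by
    conv_lhs => rw [← Matrix.dotProduct_mulVec, ← Matrix.vecMul_transpose, hQ,
      Matrix.vecMul_neg, dotProduct_neg, dotProduct_comm]
  rw [h1]
  linarith

theorem exists_continuousLinearMap_eq_rowMul (Q : Matrix (Fin (n + 1)) (Fin (n + 1)) ℝ) :
    ∃ q : 𝔽 →L[ℝ] 𝔽, ∀ x, q x = rowMul Q x := by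
  let l : 𝔽 →ₗ[ℝ] 𝔽 :=
    { toFun := rowMul Q
      map_add' := fun x y => by simp [rowMul, Matrix.add_vecMul]
      map_smul' := fun c x => by simp [rowMul, Matrix.smul_vecMul] }
  exact ⟨LinearMap.toContinuousLinearMap l, fun x => rfl⟩

end RowMul

/-! ### Spherical divergence of the Finsler gradient -/

section DivergenceOfGradient

variable {n : ℕ}

local notation "𝔼" => EuclideanSpace ℝ (Fin n)
local notation "𝔽" => EuclideanSpace ℝ (Fin (n + 1))

/-- The function `|∇Φ - kΦx| + ⟨∇Φ, xQ⟩`, which on the sphere is the dual Randers norm of the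
differential of `Φ`. -/
def dualNormGrad (Q : Matrix (Fin (n + 1)) (Fin (n + 1)) ℝ) (Φ : 𝔽 → ℝ) (k : ℝ) (x : 𝔽) : ℝ :=
  ‖tangentialGrad Φ k x‖ + inner ℝ (gradient Φ x) (rowMul Q x)

/-- A vector field which at the points of the sphere is the Finsler gradient of `Φ`. -/
def randersGrad (Q : Matrix (Fin (n + 1)) (Fin (n + 1)) ℝ) (Φ : 𝔽 → ℝ) (k : ℝ) (x : 𝔽) : 𝔽 :=
  dualNormGrad Q Φ k x • (‖tangentialGrad Φ k x‖⁻¹ • tangentialGrad Φ k x + rowMul Q x)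

theorem inner_tangentialGrad_rowMul {Q : Matrix (Fin (n + 1)) (Fin (n + 1)) ℝ}
    (hQ : Q.transpose = -Q) (Φ : 𝔽 → ℝ) (k : ℝ) (x : 𝔽) :
    inner ℝ (tangentialGrad Φ k x) (rowMul Q x) = inner ℝ (gradient Φ x) (rowMul Q x) := by
  rw [tangentialGrad, inner_sub_left, inner_smul_left, inner_rowMul_self hQ, mul_zero, sub_zero]

theorem hasFDerivAt_tangentialGrad {Φ : 𝔽 → ℝ} {p : 𝔽} (hΦ : ContDiffAt ℝ ∞ Φ p) (k : ℝ) :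
    HasFDerivAt (tangentialGrad Φ k) (fderiv ℝ (gradient Φ) p -
      ((k * Φ p) • ContinuousLinearMap.id ℝ 𝔽 + (k • fderiv ℝ Φ p).smulRight p)) p := by
  have hd : DifferentiableAt ℝ Φ p := hΦ.differentiableAt (by simp)
  have hG := ((contDiffAt_gradient hΦ).differentiableAt (by simp)).hasFDerivAt
  exact hG.sub ((hd.hasFDerivAt.const_mul k).smul (hasFDerivAt_id p))

/-- The tangential trace of the Hessian is the Laplacian minus the radial part k(k - 1)Φ, and the
term kΦx contributes a further -nkΦ. -/
theorem sum_inner_fderiv_tangentialGrad {k : ℝ} {Φ : 𝔽 → ℝ}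
    (hom : ∀ (t : ℝ) (x : 𝔽), 0 < t → Φ (t • x) = t ^ k * Φ x) {p : 𝔽}
    (hΦ : ContDiffAt ℝ ∞ Φ p) (hp : ‖p‖ = 1) {U : 𝔼 →ₗᵢ[ℝ] 𝔽}
    (hU : ∀ u, inner ℝ p (U u) = 0) :
    ∑ i, inner ℝ (U (EuclideanSpace.single i 1))
      (fderiv ℝ (tangentialGrad Φ k) p (U (EuclideanSpace.single i 1))) =
      Laplacian.laplacian Φ p - k * (k + n - 1) * Φ p := by
  have h1 : ∀ i : Fin n, inner ℝ (U (EuclideanSpace.single i 1))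
      (fderiv ℝ (tangentialGrad Φ k) p (U (EuclideanSpace.single i 1))) =
      inner ℝ (fderiv ℝ (gradient Φ) p (U (EuclideanSpace.single i 1)))
        (U (EuclideanSpace.single i 1)) - k * Φ p := by
    intro i
    rw [(hasFDerivAt_tangentialGrad hΦ k).fderiv]
    simp only [sub_apply, add_apply, smul_apply, ContinuousLinearMap.smulRight_apply,
      ContinuousLinearMap.id_apply, inner_sub_right, inner_add_right, inner_smul_right]
    rw [real_inner_comm p, hU, real_inner_self_eq_norm_sq, U.norm_map, real_inner_comm]
    simp
  rw [Finset.sum_congr rfl fun i _ => h1 i, Finset.sum_sub_distrib, laplacian_eq_add_sum hΦ hp hU,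
    inner_fderiv_gradient_self hom hΦ]
  simp
  ring

theorem differentiableAt_inner_gradient_rowMul (Q : Matrix (Fin (n + 1)) (Fin (n + 1)) ℝ)
    {Φ : 𝔽 → ℝ} {p : 𝔽} (hΦ : ContDiffAt ℝ ∞ Φ p) :
    DifferentiableAt ℝ (fun z => inner ℝ (gradient Φ z) (rowMul Q z)) p := by
  obtain ⟨q, hq⟩ := exists_continuousLinearMap_eq_rowMul Q
  simp only [← hq]
  exact ((contDiffAt_gradient hΦ).differentiableAt (by simp)).inner ℝ q.differentiableAt

theorem differentiableAt_norm_tangentialGrad {Φ : 𝔽 → ℝ} {p : 𝔽} (hΦ : ContDiffAt ℝ ∞ Φ p)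
    {k : ℝ} (hτ : tangentialGrad Φ k p ≠ 0) :
    DifferentiableAt ℝ (fun z => ‖tangentialGrad Φ k z‖) p :=
  (hasFDerivAt_tangentialGrad hΦ k).differentiableAt.norm ℝ hτ

theorem differentiableAt_dualNormGrad (Q : Matrix (Fin (n + 1)) (Fin (n + 1)) ℝ)
    {Φ : 𝔽 → ℝ} {p : 𝔽} (hΦ : ContDiffAt ℝ ∞ Φ p) {k : ℝ} (hτ : tangentialGrad Φ k p ≠ 0) :
    DifferentiableAt ℝ (dualNormGrad Q Φ k) p :=
  (differentiableAt_norm_tangentialGrad hΦ hτ).add (differentiableAt_inner_gradient_rowMul Q hΦ)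

theorem hasFDerivAt_randersGrad {Q : Matrix (Fin (n + 1)) (Fin (n + 1)) ℝ} {q : 𝔽 →L[ℝ] 𝔽}
    (hq : ∀ x, q x = rowMul Q x) {Φ : 𝔽 → ℝ} {p : 𝔽} (hΦ : ContDiffAt ℝ ∞ Φ p) {k : ℝ}
    (hτ : tangentialGrad Φ k p ≠ 0) :
    HasFDerivAt (randersGrad Q Φ k)
      (dualNormGrad Q Φ k p • (‖tangentialGrad Φ k p‖⁻¹ • fderiv ℝ (tangentialGrad Φ k) p +
        (-(‖tangentialGrad Φ k p‖ ^ 2)⁻¹ •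
          fderiv ℝ (fun z => ‖tangentialGrad Φ k z‖) p).smulRight (tangentialGrad Φ k p) + q) +
      (fderiv ℝ (dualNormGrad Q Φ k) p).smulRight
        (‖tangentialGrad Φ k p‖⁻¹ • tangentialGrad Φ k p + rowMul Q p)) p := by
  have h1 := (differentiableAt_dualNormGrad Q hΦ hτ).hasFDerivAt
  have h2 := (hasFDerivAt_tangentialGrad hΦ k).differentiableAt.hasFDerivAt
  have h3 := (differentiableAt_norm_tangentialGrad hΦ hτ).hasFDerivAt
  have h4 : HasFDerivAt (fun z => ‖tangentialGrad Φ k z‖⁻¹) _ p :=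
    (hasDerivAt_inv (norm_ne_zero_iff.2 hτ)).comp_hasFDerivAt p h3
  have h5 := h1.smul ((h4.smul h2).add q.hasFDerivAt)
  rw [← hq]
  refine (h5.congr_of_eventuallyEq (Filter.Eventually.of_forall fun z => ?_))
  simp [randersGrad, hq]

/-- The spherical divergence of the Finsler gradient, at a point where the dual norm of the
differential of `Φ` is, to first order along the sphere, a function of `Φ`. -/
theorem sum_inner_fderiv_randersGrad {Q : Matrix (Fin (n + 1)) (Fin (n + 1)) ℝ}
    (hQ : Q.transpose = -Q) {k : ℝ} {Φ : 𝔽 → ℝ}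
    (hom : ∀ (t : ℝ) (x : 𝔽), 0 < t → Φ (t • x) = t ^ k * Φ x) {p : 𝔽}
    (hΦ : ContDiffAt ℝ ∞ Φ p) (hp : ‖p‖ = 1) {U : 𝔼 →ₗᵢ[ℝ] 𝔽}
    (hU : ∀ u, inner ℝ p (U u) = 0) (hτ : tangentialGrad Φ k p ≠ 0) {c : ℝ}
    (hc : ∀ u, fderiv ℝ (dualNormGrad Q Φ k) p (U u) = c * inner ℝ (tangentialGrad Φ k p) (U u)) :
    ∑ i, inner ℝ (U (EuclideanSpace.single i 1))
      (fderiv ℝ (randersGrad Q Φ k) p (U (EuclideanSpace.single i 1))) =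
      dualNormGrad Q Φ k p *
        ((Laplacian.laplacian Φ p - k * (k + n - 1) * Φ p) / ‖tangentialGrad Φ k p‖ +
          inner ℝ (gradient (fun z => inner ℝ (gradient Φ z) (rowMul Q z)) p)
            (tangentialGrad Φ k p) / (‖gradient Φ p‖ ^ 2 - k ^ 2 * Φ p ^ 2)) := by
  obtain ⟨q, hq⟩ := exists_continuousLinearMap_eq_rowMul Q
  have hd : DifferentiableAt ℝ Φ p := hΦ.differentiableAt (by simp)
  have hτp := inner_tangentialGrad_self hom hp hd
  have hτn : ‖tangentialGrad Φ k p‖ ≠ 0 := norm_ne_zero_iff.2 hτ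
  have hc' : ∀ v, inner ℝ p v = 0 →
      fderiv ℝ (dualNormGrad Q Φ k) p v = c * inner ℝ (tangentialGrad Φ k p) v := by
    intro v hv
    obtain ⟨u, rfl⟩ := exists_isometry_eq_of_orthogonal hp hU hv
    exact hc u
  have hY : inner ℝ p (‖tangentialGrad Φ k p‖⁻¹ • tangentialGrad Φ k p + rowMul Q p) = 0 := by
    rw [inner_add_right, inner_smul_right, hτp, inner_rowMul_self hQ]
    simp
  have hA : fderiv ℝ (dualNormGrad Q Φ k) p = fderiv ℝ (fun z => ‖tangentialGrad Φ k z‖) p +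
      fderiv ℝ (fun z => inner ℝ (gradient Φ z) (rowMul Q z)) p :=
    fderiv_add (differentiableAt_norm_tangentialGrad hΦ hτ)
      (differentiableAt_inner_gradient_rowMul Q hΦ)
  have h1 := sum_apply_mul_inner_of_orthogonal hp hU hY (fderiv ℝ (dualNormGrad Q Φ k) p)
  have h2 := sum_apply_mul_inner_of_orthogonal hp hU hτp
    (fderiv ℝ (fun z => ‖tangentialGrad Φ k z‖) p)
  have h3 := sum_inner_fderiv_tangentialGrad hom hΦ hp hU
  -- The derivative q of the wind contributes nothing to the diagonal, since Q is skew.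
  have h4 : ∀ i : Fin n, inner ℝ (U (EuclideanSpace.single i 1))
      (fderiv ℝ (randersGrad Q Φ k) p (U (EuclideanSpace.single i 1))) =
      dualNormGrad Q Φ k p * (‖tangentialGrad Φ k p‖⁻¹ *
        inner ℝ (U (EuclideanSpace.single i 1))
          (fderiv ℝ (tangentialGrad Φ k) p (U (EuclideanSpace.single i 1))) -
        (‖tangentialGrad Φ k p‖ ^ 2)⁻¹ *
          (fderiv ℝ (fun z => ‖tangentialGrad Φ k z‖) p (U (EuclideanSpace.single i 1)) *
            inner ℝ (U (EuclideanSpace.single i 1)) (tangentialGrad Φ k p))) +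
      fderiv ℝ (dualNormGrad Q Φ k) p (U (EuclideanSpace.single i 1)) *
        inner ℝ (U (EuclideanSpace.single i 1))
          (‖tangentialGrad Φ k p‖⁻¹ • tangentialGrad Φ k p + rowMul Q p) := by
    intro i
    rw [(hasFDerivAt_randersGrad hq hΦ hτ).fderiv]
    simp only [add_apply, smul_apply, ContinuousLinearMap.smulRight_apply, smul_eq_mul,
      inner_add_right _ (_ • (_ : 𝔽)), inner_add_right, inner_smul_right, hq, inner_rowMul_self hQ]
    ring
  rw [Finset.sum_congr rfl fun i _ => h4 i, Finset.sum_add_distrib, h1, ← Finset.mul_sum,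
    Finset.sum_sub_distrib, ← Finset.mul_sum, ← Finset.mul_sum, h2, h3, hc' _ hY,
    ← norm_tangentialGrad_sq hom hp hd, inner_gradient_eq_fderiv, inner_add_right,
    inner_smul_right, inner_tangentialGrad_rowMul hQ]
  -- Evaluating dA on τ gives d|τ|(τ) = c|τ|² - d⟨∇Φ, xQ⟩(τ). The resulting -cA cancels dA(τ/|τ| +
  -- xQ) = c(|τ| + ⟨τ, xQ⟩) = cA.
  have h5 := hc' _ hτp
  rw [hA, add_apply, real_inner_self_eq_norm_sq] at h5
  rw [eq_sub_of_add_eq h5, real_inner_self_eq_norm_sq, dualNormGrad]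
  field_simp
  ring

end DivergenceOfGradient

/-! ### Finsler gradient and Laplacian of the restriction to the sphere -/

section Sphere

variable {n : ℕ}

local notation "𝔼" => EuclideanSpace ℝ (Fin n)
local notation "𝔽" => EuclideanSpace ℝ (Fin (n + 1))

theorem norm_coe_unitSphere (x : UnitSphere n) : ‖(x : 𝔽)‖ = 1 := by simp

theorem differentiableAt_coe_unitSphere {Φ : 𝔽 → ℝ} (hC1 : ContDiffOn ℝ 1 Φ {0}ᶜ)
    (x : UnitSphere n) : DifferentiableAt ℝ Φ (x : 𝔽) :=
  (hC1.contDiffAt (isOpen_compl_singleton.mem_nhds (ne_zero_of_mem_unit_sphere x))).differentiableAt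
    one_ne_zero

/-- The radial term of `tangentialGrad` pairs to zero with tangent vectors, so this holds for every
k; homogeneity enters only to make `tangentialGrad` itself tangent. -/
theorem differential_restrict_apply {Φ : 𝔽 → ℝ} {x : UnitSphere n}
    (hd : DifferentiableAt ℝ Φ (x : 𝔽)) (k : ℝ) (v : TangentSpace (𝓡 n) x) :
    differential (n := n) (fun x : UnitSphere n => Φ (x : 𝔽)) x v =
      inner ℝ (tangentialGrad Φ k (x : 𝔽)) (sphereIncl x v) := by
  have h1 := mfderiv_comp x (I' := 𝓘(ℝ, 𝔽)) (g := Φ) hd.mdifferentiableAt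
    (mdifferentiableAt_coe_sphere x)
  have h2 : differential (n := n) (fun x : UnitSphere n => Φ (x : 𝔽)) x v =
      fderiv ℝ Φ (x : 𝔽) (sphereIncl x v) := by
    rw [mfderiv_eq_fderiv] at h1
    exact DFunLike.congr_fun h1 v
  rw [h2, tangentialGrad, inner_sub_left, inner_smul_left, inner_coe_sphereIncl,
    inner_gradient_eq_fderiv]
  simp

theorem mem_regularSet_restrict_iff {k : ℝ} {Φ : 𝔽 → ℝ}
    (hom : ∀ (t : ℝ) (x : 𝔽), 0 < t → Φ (t • x) = t ^ k * Φ x)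
    {x : UnitSphere n} (hd : DifferentiableAt ℝ Φ (x : 𝔽)) :
    x ∈ regularSet n (fun x : UnitSphere n => Φ (x : 𝔽)) ↔
      tangentialGrad Φ k (x : 𝔽) ≠ 0 := by
  refine not_congr ⟨fun h => ?_, fun h => ?_⟩
  · obtain ⟨t, ht⟩ := exists_sphereIncl_eq x
      (inner_tangentialGrad_self hom (norm_coe_unitSphere x) hd)
    have h1 := differential_restrict_apply hd k t
    rw [h, ht] at h1
    exact inner_self_eq_zero.1 h1.symm
  · refine ContinuousLinearMap.ext fun v => ?_
    rw [differential_restrict_apply hd k, h, inner_zero_left]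
    rfl

theorem sphereRegularSet_eq_image {k : ℝ} {Φ : 𝔽 → ℝ}
    (hom : ∀ (t : ℝ) (x : 𝔽), 0 < t → Φ (t • x) = t ^ k * Φ x)
    (hC1 : ContDiffOn ℝ 1 Φ {0}ᶜ) :
    (fun x : UnitSphere n => Φ (x : 𝔽)) '' regularSet n (fun x : UnitSphere n => Φ (x : 𝔽)) =
      Φ '' sphereRegularSet Φ k := by
  ext y
  constructor
  · rintro ⟨x, hx, rfl⟩
    exact ⟨x, ⟨x.2, (mem_regularSet_restrict_iff hom
      (differentiableAt_coe_unitSphere hC1 x)).1 hx⟩, rfl⟩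
  · rintro ⟨x, ⟨hx, hτ⟩, rfl⟩
    exact ⟨⟨x, hx⟩, (mem_regularSet_restrict_iff hom
      (differentiableAt_coe_unitSphere hC1 ⟨x, hx⟩)).2 hτ, rfl⟩

theorem finslerGradient_randersMetric {Q : Matrix (Fin (n + 1)) (Fin (n + 1)) ℝ}
    (hQ : Q.transpose = -Q) {W : ∀ x : UnitSphere n, TangentSpace (𝓡 n) x}
    (hW : ∀ x : UnitSphere n, sphereIncl x (W x) = rowMul Q (x : 𝔽))
    {x : UnitSphere n} (hw : ‖sphereIncl x (W x)‖ < 1) {k : ℝ} {Φ : 𝔽 → ℝ}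
    (hom : ∀ (t : ℝ) (x : 𝔽), 0 < t → Φ (t • x) = t ^ k * Φ x)
    (hd : DifferentiableAt ℝ Φ (x : 𝔽)) (hτ : tangentialGrad Φ k (x : 𝔽) ≠ 0) :
    sphereIncl x (finslerGradient (randersMetric sphereMetric W)
      (fun x : UnitSphere n => Φ (x : 𝔽)) x) = randersGrad Q Φ k (x : 𝔽) := by
  obtain ⟨t, ht⟩ := exists_sphereIncl_eq x
    (inner_tangentialGrad_self hom (norm_coe_unitSphere x) hd)
  have ht0 : sphereIncl x t ≠ 0 := by rw [ht]; exact hτ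
  have key : ∀ y : TangentSpace (𝓡 n) x, legendre (randersMetric sphereMetric W) x y =
      differential (fun x : UnitSphere n => Φ (x : 𝔽)) x ↔
      y = (‖sphereIncl x t‖ + inner ℝ (sphereIncl x t) (sphereIncl x (W x))) •
        (‖sphereIncl x t‖⁻¹ • t + W x) := by
    intro y
    have h1 : differential (fun x : UnitSphere n => Φ (x : 𝔽)) x =
        (innerSL ℝ (sphereIncl x t)).comp (sphereIncl x) := by
      refine ContinuousLinearMap.ext fun v => ?_
      rw [differential_restrict_apply hd k, ht]
      rfl
    rw [h1]
    exact legendre_navigationNorm_iff (T := 𝔼) (J := sphereIncl x) (sphereIncl_injective x) hw ht0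
  -- The reverse direction of `key` provides a preimage, so `invFun` returns one; the forward
  -- direction identifies it.
  have h2 := (key _).1 (Function.invFun_eq ⟨_, (key _).2 rfl⟩)
  rw [finslerGradient, h2, map_smul, map_add, map_smul, ht, hW, inner_tangentialGrad_rowMul hQ]
  rfl

theorem randersMetric_finslerGradient {Q : Matrix (Fin (n + 1)) (Fin (n + 1)) ℝ}
    (hQ : Q.transpose = -Q) {W : ∀ x : UnitSphere n, TangentSpace (𝓡 n) x}
    (hW : ∀ x : UnitSphere n, sphereIncl x (W x) = rowMul Q (x : 𝔽))
    {x : UnitSphere n} (hw : ‖sphereIncl x (W x)‖ < 1) {k : ℝ} {Φ : 𝔽 → ℝ}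
    (hom : ∀ (t : ℝ) (x : 𝔽), 0 < t → Φ (t • x) = t ^ k * Φ x)
    (hd : DifferentiableAt ℝ Φ (x : 𝔽)) (hτ : tangentialGrad Φ k (x : 𝔽) ≠ 0) :
    randersMetric sphereMetric W x (finslerGradient (randersMetric sphereMetric W)
      (fun x : UnitSphere n => Φ (x : 𝔽)) x) = dualNormGrad Q Φ k (x : 𝔽) := by
  rw [randersMetric_eq_navigationNorm, finslerGradient_randersMetric hQ hW hw hom hd hτ,
    randersGrad, dualNormGrad, ← inner_tangentialGrad_rowMul hQ Φ k, ← hW]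
  exact navigationNorm_dual hw hτ

theorem eventually_tangentialGrad_ne_zero {k : ℝ} {Φ : 𝔽 → ℝ} {p : 𝔽}
    (hΦ : ContDiffAt ℝ ∞ Φ p) (hτ : tangentialGrad Φ k p ≠ 0) (U : 𝔼 →ₗᵢ[ℝ] 𝔽) :
    ∀ᶠ u in nhds (0 : 𝔼), tangentialGrad Φ k (stereoParam U p u) ≠ 0 := by
  have h1 : ContinuousAt (fun u => stereoParam U p u) 0 :=
    (hasFDerivAt_stereoParam U p 0).continuousAt
  have h2 : ContinuousAt (tangentialGrad Φ k) (stereoParam U p 0) := by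
    rw [stereoParam_zero]
    exact (hasFDerivAt_tangentialGrad hΦ k).continuousAt
  refine (ContinuousAt.comp h2 h1).eventually_ne ?_
  simpa [stereoParam_zero] using hτ

/-- The restriction of Φ is a submersion at a regular point, hence open there, and nearby points
stay regular. Thus smoothness of a function on the image yields a genuine derivative at Φ(p). -/
theorem image_sphereRegularSet_mem_nhds {k : ℝ} {Φ : 𝔽 → ℝ}
    (hom : ∀ (t : ℝ) (x : 𝔽), 0 < t → Φ (t • x) = t ^ k * Φ x) {p : UnitSphere n}
    (hΦ : ContDiffAt ℝ ∞ Φ (p : 𝔽)) (hτ : tangentialGrad Φ k (p : 𝔽) ≠ 0) :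
    Φ '' sphereRegularSet Φ k ∈ nhds (Φ (p : 𝔽)) := by
  obtain ⟨U, hU, hι⟩ := exists_extChartAt_sphere_symm_eq p
  have hd : DifferentiableAt ℝ Φ (p : 𝔽) := hΦ.differentiableAt (by simp)
  have hp := norm_coe_unitSphere p
  have h1 : ContDiffAt ℝ 1 (fun u => Φ (stereoParam U (p : 𝔽) u)) 0 := by
    have h2 : ContDiffAt ℝ 1 (stereoParam U (p : 𝔽)) 0 := by
      have h3 : ContDiff ℝ 1 fun u : 𝔼 => (‖u‖ ^ 2 + 4)⁻¹ :=
        ((contDiff_norm_sq ℝ).add contDiff_const).inv fun u => by positivity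
      have h4 : ContDiff ℝ 1 fun u : 𝔼 => (4 - ‖u‖ ^ 2) • (p : 𝔽) :=
        (contDiff_const.sub (contDiff_norm_sq ℝ)).smul contDiff_const
      exact (h3.smul ((U.contDiff.const_smul (4 : ℝ)).add h4)).contDiffAt
    have h5 : ContDiffAt ℝ 1 Φ (stereoParam U (p : 𝔽) 0) := by
      rw [stereoParam_zero]; exact hΦ.of_le (by simp)
    exact h5.comp 0 h2
  have h2 : HasFDerivAt (fun u => Φ (stereoParam U (p : 𝔽) u))
      ((fderiv ℝ Φ (p : 𝔽)).comp (stereoParamDeriv U (p : 𝔽) 0)) 0 := by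
    have h3 : HasFDerivAt Φ (fderiv ℝ Φ (p : 𝔽)) (stereoParam U (p : 𝔽) 0) := by
      rw [stereoParam_zero]; exact hd.hasFDerivAt
    exact h3.comp 0 (hasFDerivAt_stereoParam U (p : 𝔽) 0)
  have h3 := h1.hasStrictFDerivAt' h2 one_ne_zero
  obtain ⟨t, ht⟩ := exists_isometry_eq_of_orthogonal hp hU (inner_tangentialGrad_self hom hp hd)
  have h4 : fderiv ℝ Φ (p : 𝔽) (U t) ≠ 0 := by
    have h5 : fderiv ℝ Φ (p : 𝔽) (U t) = ‖tangentialGrad Φ k (p : 𝔽)‖ ^ 2 := by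
      rw [← real_inner_self_eq_norm_sq]
      nth_rewrite 2 [← ht]
      rw [tangentialGrad, inner_sub_left, inner_smul_left, hU, inner_gradient_eq_fderiv]
      simp
    rw [h5]
    exact pow_ne_zero 2 (norm_ne_zero_iff.2 hτ)
  have h5 : ((fderiv ℝ Φ (p : 𝔽)).comp (stereoParamDeriv U (p : 𝔽) 0)).range = ⊤ := by
    refine LinearMap.range_eq_top.2 fun y => ⟨(y / fderiv ℝ Φ (p : 𝔽) (U t)) • t, ?_⟩
    simp [stereoParamDeriv_zero, h4]
  have h6 := h3.map_nhds_eq_of_surj h5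
  rw [stereoParam_zero] at h6
  rw [← h6, Filter.mem_map]
  filter_upwards [eventually_tangentialGrad_ne_zero hΦ hτ U] with u hu
  exact ⟨_, ⟨by rw [← hι]; exact Subtype.property _, hu⟩, rfl⟩

theorem finslerLaplacian_randersMetric {Q : Matrix (Fin (n + 1)) (Fin (n + 1)) ℝ}
    (hQ : Q.transpose = -Q) {W : ∀ x : UnitSphere n, TangentSpace (𝓡 n) x}
    (hW : ∀ x : UnitSphere n, sphereIncl x (W x) = rowMul Q (x : 𝔽))
    (hw : ∀ x : UnitSphere n, ‖sphereIncl x (W x)‖ < 1) {k : ℝ} {Φ : 𝔽 → ℝ}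
    (hom : ∀ (t : ℝ) (x : 𝔽), 0 < t → Φ (t • x) = t ^ k * Φ x)
    (hC1 : ContDiffOn ℝ 1 Φ {0}ᶜ)
    (hsmooth : ∀ x ∈ sphereRegularSet Φ k, ContDiffAt ℝ ∞ Φ x) {a : ℝ → ℝ}
    (ha : ContDiffOn ℝ ∞ a (Φ '' sphereRegularSet Φ k))
    (hA : ∀ x ∈ sphereRegularSet Φ k, dualNormGrad Q Φ k x = a (Φ x))
    {p : UnitSphere n} (hp : (p : 𝔽) ∈ sphereRegularSet Φ k) :
    finslerLaplacian (randersMetric sphereMetric W) (bhDensity (randersMetric sphereMetric W))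
      (fun x : UnitSphere n => Φ (x : 𝔽)) p =
      a (Φ p) *
        ((Laplacian.laplacian Φ (p : 𝔽) - k * (k + n - 1) * Φ p) /
            ‖tangentialGrad Φ k (p : 𝔽)‖ +
          inner ℝ (gradient (fun z => inner ℝ (gradient Φ z) (rowMul Q z)) (p : 𝔽))
            (tangentialGrad Φ k (p : 𝔽)) /
              (‖gradient Φ (p : 𝔽)‖ ^ 2 - k ^ 2 * Φ p ^ 2)) := by
  obtain ⟨U, hU, hι⟩ := exists_extChartAt_sphere_symm_eq p
  have hΦ := hsmooth _ hp
  have hτ := hp.2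
  have hd : DifferentiableAt ℝ Φ (p : 𝔽) := hΦ.differentiableAt (by simp)
  obtain ⟨q, hq⟩ := exists_continuousLinearMap_eq_rowMul Q
  have hev := eventually_tangentialGrad_ne_zero hΦ hτ U
  have hXV : ∀ᶠ u in nhds (0 : 𝔼), sphereIncl ((extChartAt (𝓡 n) p).symm u)
      (finslerGradient (randersMetric sphereMetric W) (fun x : UnitSphere n => Φ (x : 𝔽))
        ((extChartAt (𝓡 n) p).symm u)) = randersGrad Q Φ k (stereoParam U (p : 𝔽) u) := by
    filter_upwards [hev] with u hu
    rw [← hι] at hu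
    rw [finslerGradient_randersMetric hQ hW (hw _) hom
      (differentiableAt_coe_unitSphere hC1 _) hu, hι]
  -- The identity A = a(Φ) holds only on the sphere, so it is differentiated through the
  -- parametrization. This gives c = a'(Φ(p)).
  have hc : ∀ u, fderiv ℝ (dualNormGrad Q Φ k) (p : 𝔽) (U u) =
      deriv a (Φ p) * inner ℝ (tangentialGrad Φ k (p : 𝔽)) (U u) := by
    intro u
    have h1 : HasFDerivAt (fun u => dualNormGrad Q Φ k (stereoParam U (p : 𝔽) u))
        ((fderiv ℝ (dualNormGrad Q Φ k) (p : 𝔽)).comp (stereoParamDeriv U (p : 𝔽) 0)) 0 := by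
      have h3 : HasFDerivAt (dualNormGrad Q Φ k) (fderiv ℝ (dualNormGrad Q Φ k) (p : 𝔽))
          (stereoParam U (p : 𝔽) 0) := by
        rw [stereoParam_zero]; exact (differentiableAt_dualNormGrad Q hΦ hτ).hasFDerivAt
      exact h3.comp 0 (hasFDerivAt_stereoParam U (p : 𝔽) 0)
    have h2 : HasFDerivAt (fun u => a (Φ (stereoParam U (p : 𝔽) u)))
        (deriv a (Φ p) • (fderiv ℝ Φ (p : 𝔽)).comp (stereoParamDeriv U (p : 𝔽) 0)) 0 := by
      have h3 : HasFDerivAt Φ (fderiv ℝ Φ (p : 𝔽)) (stereoParam U (p : 𝔽) 0) := by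
        rw [stereoParam_zero]; exact hd.hasFDerivAt
      have h4 : HasDerivAt a (deriv a (Φ p)) (Φ (stereoParam U (p : 𝔽) 0)) := by
        rw [stereoParam_zero]
        exact ((ha.contDiffAt (image_sphereRegularSet_mem_nhds hom hΦ hτ)).differentiableAt
          (by simp)).hasDerivAt
      exact h4.comp_hasFDerivAt (0 : 𝔼) (h3.comp 0 (hasFDerivAt_stereoParam U (p : 𝔽) 0))
    have h3 : (fun u => dualNormGrad Q Φ k (stereoParam U (p : 𝔽) u)) =ᶠ[nhds 0]
        fun u => a (Φ (stereoParam U (p : 𝔽) u)) := by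
      filter_upwards [hev] with u hu
      exact hA _ ⟨by rw [← hι]; exact Subtype.property _, hu⟩
    have h4 := DFunLike.congr_fun (h1.unique (h2.congr_of_eventuallyEq h3)) u
    simp only [ContinuousLinearMap.comp_apply, smul_apply, stereoParamDeriv_zero,
      smul_eq_mul] at h4
    rw [h4, tangentialGrad, inner_sub_left, inner_smul_left, hU, inner_gradient_eq_fderiv]
    simp
  rw [finslerLaplacian, divergence_bhDensity_randersMetric hw hU hι
    (hasFDerivAt_randersGrad hq hΦ hτ).differentiableAt hXV,
    sum_inner_fderiv_randersGrad hQ hom hΦ (norm_coe_unitSphere p) hU hτ hc, hA _ hp]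

end Sphere

/-! ### The equivalence -/

theorem mainTheorem5 (n : ℕ) (hn : 1 ≤ n)
    (Q : Matrix (Fin (n + 1)) (Fin (n + 1)) ℝ) (hQ : Q.transpose = -Q)
    (hQ1 : ∀ x : UnitSphere n, ‖rowMul Q (x : EuclideanSpace ℝ (Fin (n + 1)))‖ < 1)
    (W : ∀ x : UnitSphere n, TangentSpace (𝓡 n) x)
    (hW : ∀ x : UnitSphere n,
      sphereIncl x (W x) = rowMul Q (x : EuclideanSpace ℝ (Fin (n + 1))))
    (k : ℝ) (Φ : EuclideanSpace ℝ (Fin (n + 1)) → ℝ)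
    (hom : ∀ (t : ℝ) (x : EuclideanSpace ℝ (Fin (n + 1))), 0 < t → Φ (t • x) = t ^ k * Φ x)
    (hC1 : ContDiffOn ℝ 1 Φ {0}ᶜ)
    (hsmooth : ∀ x ∈ sphereRegularSet Φ k, ContDiffAt ℝ ∞ Φ x)
    (hnc : ¬ ∃ c : ℝ, ∀ x : UnitSphere n, Φ (x : EuclideanSpace ℝ (Fin (n + 1))) = c) :
    IsIsoparametric (randersMetric sphereMetric W) (bhDensity (randersMetric sphereMetric W))
        (fun x : UnitSphere n => Φ (x : EuclideanSpace ℝ (Fin (n + 1)))) ↔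
      ∃ φ ψ : ℝ → ℝ,
        ContDiffOn ℝ ∞ φ (Φ '' sphereRegularSet Φ k) ∧
        ContinuousOn ψ (Φ '' sphereRegularSet Φ k) ∧
        ∀ x ∈ sphereRegularSet Φ k,
          ‖tangentialGrad Φ k x‖ + inner ℝ (gradient Φ x) (rowMul Q x) = φ (Φ x) ∧
          (Laplacian.laplacian Φ x - k * (k + n - 1) * Φ x) / ‖tangentialGrad Φ k x‖
            + inner ℝ (gradient (fun z => inner ℝ (gradient Φ z) (rowMul Q z)) x)
                (tangentialGrad Φ k x)
              / (‖gradient Φ x‖ ^ 2 - k ^ 2 * Φ x ^ 2) = ψ (Φ x) := by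
  have hw : ∀ x : UnitSphere n, ‖sphereIncl x (W x)‖ < 1 := fun x => by rw [hW]; exact hQ1 x
  have hdiff := differentiableAt_coe_unitSphere hC1
  have hreg := fun x : UnitSphere n => mem_regularSet_restrict_iff hom (hdiff x)
  have himage := sphereRegularSet_eq_image hom hC1
  have hpos : ∀ x ∈ sphereRegularSet Φ k, 0 < dualNormGrad Q Φ k x := by
    rintro x ⟨hx, hτ⟩
    rw [dualNormGrad, ← inner_tangentialGrad_rowMul hQ Φ k]
    exact norm_add_inner_pos (hQ1 ⟨x, hx⟩) hτ
  constructor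
  · rintro ⟨-, -, -, a, b, ha, hb, hab⟩
    rw [himage] at ha hb
    have hA : ∀ x ∈ sphereRegularSet Φ k, dualNormGrad Q Φ k x = a (Φ x) := by
      rintro x ⟨hx, hτ⟩
      rw [← (hab ⟨x, hx⟩ ((hreg ⟨x, hx⟩).2 hτ)).1]
      exact (randersMetric_finslerGradient hQ hW (hw ⟨x, hx⟩) hom (hdiff ⟨x, hx⟩) hτ).symm
    have ha0 : ∀ x ∈ sphereRegularSet Φ k, a (Φ x) ≠ 0 := fun x hx => by
      rw [← hA x hx]
      exact (hpos x hx).ne'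
    -- The Laplacian is a(Φ) times the second expression, and a is nonzero on the image by `hpos`;
    -- hence ψ = b/a, and b = φψ in the converse.
    refine ⟨a, fun y => b y / a y, ha, hb.div ha.continuousOn ?_, fun x hx => ⟨hA x hx, ?_⟩⟩
    · rintro _ ⟨x, hx, rfl⟩
      exact ha0 x hx
    · rw [eq_div_iff (ha0 x hx), mul_comm]
      rw [← (hab ⟨x, hx.1⟩ ((hreg ⟨x, hx.1⟩).2 hx.2)).2]
      exact (finslerLaplacian_randersMetric hQ hW hw hom hC1 hsmooth ha hA
        (p := ⟨x, hx.1⟩) hx).symm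
  · rintro ⟨φ, ψ, hφ, hψ, h⟩
    have : Fact (Module.finrank ℝ (EuclideanSpace ℝ (Fin (n + 1))) = n + 1) :=
      ⟨finrank_euclideanSpace_fin⟩
    refine ⟨hnc, fun x => ?_, fun x hx => ?_, φ, fun y => φ y * ψ y, ?_, ?_, fun x hx => ?_⟩
    · exact (hC1.contDiffAt (isOpen_compl_singleton.mem_nhds
        (ne_zero_of_mem_unit_sphere x))).contMDiffAt.comp x (contMDiff_coe_sphere x)
    · exact ((hsmooth x ⟨x.2, (hreg x).1 hx⟩).contMDiffAt.comp x
        (contMDiff_coe_sphere x)).contMDiffWithinAt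
    · rw [himage]
      exact hφ
    · rw [himage]
      exact hφ.continuousOn.mul hψ
    · have hx' : (x : EuclideanSpace ℝ (Fin (n + 1))) ∈ sphereRegularSet Φ k :=
        ⟨x.2, (hreg x).1 hx⟩
      have hA : ∀ x ∈ sphereRegularSet Φ k, dualNormGrad Q Φ k x = φ (Φ x) :=
        fun x hx => (h x hx).1
      refine ⟨?_, ?_⟩
      · rw [randersMetric_finslerGradient hQ hW (hw x) hom (hdiff x) hx'.2]
        exact hA _ hx'
      · rw [finslerLaplacian_randersMetric hQ hW hw hom hC1 hsmooth hφ hA hx', (h x hx').2]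

end
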